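/- Graphs are finite and may have parallel edges. A graph is $2$-connected if it has at least two vertices, is connected, and remains connected after the deletion of any one vertex or any one edge (so the circuit $C_2$ of length $2$ is $2$-connected, but a single vertex and $K_2$ are not); it is $3$-connected if it has more than three vertices and remains connected after the deletion of any at most two vertices. A set $\mathcal S$ of graphs is an \emph{even subdivision-factor} of a cubic graph $G$ if $G$ has a spanning subgraph $H$ such that every component of $H$ is a subdivision of an element of $\mathcal S$ and has an even number of vertices. For a $2$-connected graph $G$ let $$l(G):=\min_{C}\ \max_{v\in V(G)} d(C,v),$$ where $C$ ranges over the circuits of $G$ and $d(C,v)$ is the length of a shortest path of $G$ from a vertex of $C$ to $v$. For a set $\mathcal S$ of $2$-connected graphs let $l_m(\mathcal S):=\max_{G\in\mathcal S} l(G)$ if this maximum exists, and $l_m(\mathcal S):=\infty$ otherwise. \textbf{Theorem.} Let $\mathcal S$ be a set of $2$-connected graphs that is an even subdivision-factor of every $3$-connected cubic graph. Then $l_m(\mathcal S)=\infty$; that is, for every $n\in\mathbb N$ there is a graph $A\in\mathcal S$ with $l(A)>n$. In particular, no finite set of $2$-connected graphs is an even subdivision-factor of every $3$-connected cubic graph.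 -/

import Mathlib

/-!
Graphs are Mathlib's multigraphs `Graph α β` (parallel edges and loops are allowed), so that the
circuit of length two and the graph with two vertices and three parallel edges are covered.
-/

namespace Graph

variable {α β γ δ : Type*}

/-- A graph with finitely many vertices and edges. -/
def IsFinite (G : Graph α β) : Prop := G.vertexSet.Finite ∧ G.edgeSet.Finite

/-- The degree of a vertex: the number of edges at it, each loop being counted twice. -/
noncomputable def deg (G : Graph α β) (x : α) : ℕ∞ :=
  (G.incidenceSet x).encard + (G.loopSet x).encard

/-- Every vertex has degree three. -/
def IsCubic (G : Graph α β) : Prop := ∀ x ∈ G.vertexSet, G.deg x = 3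

/-- `G.IsWalk x w y`: starting at `x`, the list `w` of pairs (edge, next vertex) describes a walk
of `G` that ends at `y`. -/
def IsWalk (G : Graph α β) : α → List (β × α) → α → Prop
  | x, [], y => x ∈ G.vertexSet ∧ x = y
  | x, (e, z) :: w, y => G.IsLink e x z ∧ G.IsWalk z w y

/-- A path from `x` to `y`: a walk without repeated vertices. -/
def IsPath (G : Graph α β) (x : α) (w : List (β × α)) (y : α) : Prop :=
  G.IsWalk x w y ∧ (x :: w.map Prod.snd).Nodup

/-- A circuit, traversed from its vertex `x`: a closed walk with at least one edge, no repeated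
edge, and no repeated vertex except that it returns to `x` at its end. Its vertices are the
members of `w.map Prod.snd`. -/
def IsCircuit (G : Graph α β) (x : α) (w : List (β × α)) : Prop :=
  G.IsWalk x w x ∧ w ≠ [] ∧ (w.map Prod.snd).Nodup ∧ (w.map Prod.fst).Nodup

/-- Non-empty, and any two vertices are joined by a walk. -/
def IsConnected (G : Graph α β) : Prop :=
  G.vertexSet.Nonempty ∧ ∀ x ∈ G.vertexSet, ∀ y ∈ G.vertexSet, ∃ w, G.IsWalk x w y

/-- A `2`-connected multigraph: it is connected, has at least two vertices, and deleting one vertex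
or one edge does not disconnect it. (With three or more vertices, the condition on the edges
follows from the one on the vertices; with two vertices it says that these are joined by at least
two parallel edges.) -/
def IsTwoConnected (G : Graph α β) : Prop :=
  2 ≤ G.vertexSet.encard ∧ G.IsConnected ∧
    (∀ x ∈ G.vertexSet, (G.deleteVerts {x}).IsConnected) ∧
    (∀ e ∈ G.edgeSet, (G.deleteEdges {e}).IsConnected)

/-- A `3`-connected graph: it has more than three vertices, and deleting fewer than three vertices
does not disconnect it. -/
def IsThreeConnected (G : Graph α β) : Prop :=
  3 < G.vertexSet.encard ∧
    ∀ X ⊆ G.vertexSet, X.encard < 3 → (G.deleteVerts X).IsConnected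

/-- A connected component: a connected subgraph that contains every edge of `G` at its vertices. -/
def IsComponent (K G : Graph α β) : Prop := K.IsClosedSubgraph G ∧ K.IsConnected

/-- The inner vertices of the walk described by the list `w`. -/
def innerVertices (w : List (β × α)) : List α := w.dropLast.map Prod.snd

/-- `H` is a subdivision of `A` (up to isomorphism): the vertices `x` of `A` correspond to distinct
vertices `φ x` of `H`, every edge `e` of `A` is replaced by a path `P e` of `H` of length at least
one between the vertices that correspond to its ends (a circuit if `e` is a loop), the inner
vertices of these paths are new, distinct paths share no edge and no inner vertex, and
`H` consists of these vertices and paths. -/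
def IsSubdivision (H : Graph γ δ) (A : Graph α β) : Prop :=
  ∃ (φ : α → γ) (P : β → List (δ × γ)),
    Set.InjOn φ A.vertexSet ∧
    (∀ e ∈ A.edgeSet, P e ≠ [] ∧ (∃ x y, A.IsLink e x y ∧ H.IsWalk (φ x) (P e) (φ y)) ∧
      ((P e).map Prod.fst).Nodup ∧ (innerVertices (P e)).Nodup ∧
      ∀ v ∈ innerVertices (P e), v ∉ φ '' A.vertexSet) ∧
    (∀ e ∈ A.edgeSet, ∀ e' ∈ A.edgeSet, e ≠ e' →
      List.Disjoint ((P e).map Prod.fst) ((P e').map Prod.fst) ∧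
      List.Disjoint (innerVertices (P e)) (innerVertices (P e'))) ∧
    H.vertexSet = φ '' A.vertexSet ∪ {v | ∃ e ∈ A.edgeSet, v ∈ innerVertices (P e)} ∧
    H.edgeSet = {f | ∃ e ∈ A.edgeSet, f ∈ (P e).map Prod.fst}

/-- `S` is an even subdivision-factor of `G`: some spanning subgraph `H` of `G` has the property
that each of its components is a subdivision of an element of `S` and has an even number of
vertices. -/
def IsEvenSubdivisionFactor (S : Set (Graph α β)) (G : Graph γ δ) : Prop :=
  ∃ H : Graph γ δ, H.IsSpanningSubgraph G ∧ ∀ K : Graph γ δ, K.IsComponent H →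
    (∃ A ∈ S, K.IsSubdivision A) ∧ Even K.vertexSet.ncard

/-- `S` is an even subdivision-factor of every (finite) `3`-connected cubic graph. -/
def IsEvenSubdivisionFactorOfAll (S : Set (Graph α β)) : Prop :=
  ∀ (γ δ : Type) (G : Graph γ δ), G.IsFinite → G.IsThreeConnected → G.IsCubic →
    IsEvenSubdivisionFactor S G

/-- The length of a shortest path between a vertex of `X` and a vertex of `Y`. -/
noncomputable def setDist (G : Graph α β) (X Y : Set α) : ℕ∞ :=
  ⨅ (x ∈ X) (y ∈ Y) (w : List (β × α)) (_ : G.IsPath x w y), (w.length : ℕ∞)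

/-- `l(G)`: the minimum over the circuits `C` of `G` of the maximal distance between `C` and a
vertex of `G`. -/
noncomputable def nonHam (G : Graph α β) : ℕ∞ :=
  ⨅ (x : α) (w : List (β × α)) (_ : G.IsCircuit x w),
    ⨆ v ∈ G.vertexSet, G.setDist {u | u ∈ w.map Prod.snd} {v}

open Classical in
/-- `l_m(S)`: the maximum of `l` over `S` if it exists, and `∞` otherwise. -/
noncomputable def nonHamMax (S : Set (Graph α β)) : ℕ∞ :=
  if ∃ m, IsGreatest (nonHam '' S) m then sSup (nonHam '' S) else ⊤

end Graph

/-! The graphs that force large distances come from the Petersen graph `P` by iterated inflation: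
every vertex of a cubic graph is replaced by a copy of `P` minus a vertex. Such a copy has nine
vertices. As nine is odd, contracting all copies, or contracting everything outside one copy, turns
a bridgeless spanning subgraph with even components into one of the same kind
(`EvenBridgeless.contract`, `EvenBridgeless.localDarts`).

Three facts about `P` are used. It is 3-connected. Every bridgeless spanning subgraph with even
components is connected: otherwise the vertices split into two even sets inducing minimum degree
two, but girth five forces sizes five and five. A spanning subgraph with all degrees two, except
possibly at one vertex `x`, has an odd component avoiding `x`: the pentagon of a 2-factor that
misses `x`, or, when `x` is isolated, an odd component of the remaining nine vertices.

Inflation preserves the first two properties. A closed trail of the inflated graph contracts to one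
of the original graph, and inside the copy of a far vertex there is a vertex one step further away,
so the distance grows with each inflation (`Far.inflate`).

Now let `G` be such an iterate and `H` a factor of its inflation. `H` is connected, hence a
subdivision of a single `A` in the given set. In each copy `H` is connected and has a vertex of
degree three, so no subdivided edge of `A` passes through a copy other than those of its ends.
Contracting the copies therefore maps `A` to `G` so that adjacent vertices go to equal or adjacent
ones, every vertex of `G` is hit, and closed trails become closed trails. The distance from closed
trails in `G` pulls back to `A` (`Far.exists_lipschitz`). -/

/-- A loopless cubic graph without parallel edges, given by the fixed-point-free involution `opp`
on its darts: `(v, i)` is the `i`-th dart at `v`, and `opp` turns a dart around. -/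
structure CubicDartGraph (V : Type*) where
  opp : V × Fin 3 → V × Fin 3
  opp_opp : ∀ d, opp (opp d) = d
  loopless : ∀ d, (opp d).1 ≠ d.1
  simple : ∀ v i j, (opp (v, i)).1 = (opp (v, j)).1 → i = j

/-! ### Invariants of cubic graphs given by darts -/

namespace CubicDartGraph

open Finset

variable {V Q : Type*} {G : CubicDartGraph V} {P : CubicDartGraph (Option Q)}

/-- Deleting any two vertices leaves a connected graph. -/
def ThreeConnected (G : CubicDartGraph V) : Prop :=
  ∀ (a b : V) (S : Set V),
    (∀ d, d.1 ≠ a → d.1 ≠ b → (G.opp d).1 ≠ a → (G.opp d).1 ≠ b → d.1 ∈ S → (G.opp d).1 ∈ S) →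
    ∀ x y, x ≠ a → x ≠ b → y ≠ a → y ≠ b → x ∈ S → y ∈ S

/-- The set `h` of darts is the edge set of a spanning subgraph without bridges all of whose
components have an even number of vertices. -/
structure EvenBridgeless (G : CubicDartGraph V) (h : V × Fin 3 → Prop) : Prop where
  symm : ∀ d, h d → h (G.opp d)
  bridgeless : ∀ S : Set V, ¬ ∃! d, h d ∧ d.1 ∈ S ∧ (G.opp d).1 ∉ S
  even : ∀ S : Set V, (∀ d, h d → d.1 ∈ S → (G.opp d).1 ∈ S) → Even S.ncard

/-- Every bridgeless spanning subgraph with even components is connected. -/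
def EvenConnected (G : CubicDartGraph V) : Prop :=
  ∀ h, G.EvenBridgeless h → ∀ S : Set V,
    (∀ d, h d → d.1 ∈ S → (G.opp d).1 ∈ S) → S = ∅ ∨ S = Set.univ

/-- Every closed trail has a vertex at distance at least `n` from it. The trail is given by its
edges as a cycle `D` modulo two, together with a set `U` of vertices that it connects, and the
distance is bounded below by a function that changes by at most one along each edge. -/
def Far (G : CubicDartGraph V) (n : ℕ) : Prop :=
  ∀ (D : V × Fin 3 → ZMod 2) (U : Set V), (∀ d, D (G.opp d) = D d) → (∀ v, ∑ i, D (v, i) = 0) →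
    (∀ S : Set V, (∀ d, D d ≠ 0 → d.1 ∈ S → (G.opp d).1 ∈ S) → ∀ x ∈ U, ∀ y ∈ U, x ∈ S → y ∈ S) →
    ∃ f : V → ℕ, (∀ d, f d.1 ≤ f (G.opp d).1 + 1) ∧ (∀ u ∈ U, f u = 0) ∧ ∃ v, n ≤ f v

/-- Every spanning subgraph with all degrees two, except possibly at `none`, has an odd component
that avoids `none`. -/
def OddFactor (P : CubicDartGraph (Option Q)) : Prop :=
  ∀ h : Option Q × Fin 3 → Prop, (∀ d, h d → h (P.opp d)) →
    (∀ q, ∃ i, ¬ h (some q, i) ∧ ∀ j ≠ i, h (some q, j)) →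
    ∃ S : Set (Option Q), none ∉ S ∧ Odd S.ncard ∧ ∀ d, h d → d.1 ∈ S → (P.opp d).1 ∈ S

/-- An isolated vertex would be an odd component, and the edge at a vertex of degree one would be a
bridge. -/
lemma EvenBridgeless.two_le_degree {h} (hh : G.EvenBridgeless h) (v : V) :
    ∃ i, ∀ j ≠ i, h (v, j) := by
  by_contra! hc
  have h0 : ∃ i, h (v, i) := by
    by_contra! h0
    have := hh.even {v} (by
      rintro ⟨w, i⟩ hd hw
      obtain rfl : w = v := hw
      exact absurd hd (h0 i))
    simp at this
  obtain ⟨i, hi⟩ := h0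
  have huniq : ∀ j, h (v, j) → j = i := by
    intro j hj
    by_contra hji
    obtain ⟨k, hk⟩ : ∃ k : Fin 3, k ≠ i ∧ k ≠ j ∧ ∀ l, l ≠ k → l = i ∨ l = j := by
      clear hi hj hc
      revert i j; decide
    obtain ⟨l, hl, hl'⟩ := hc k
    rcases hk.2.2 l hl with rfl | rfl <;> contradiction
  refine hh.bridgeless {v} ⟨(v, i), ⟨hi, rfl, G.loopless _⟩, ?_⟩
  rintro ⟨w, j⟩ ⟨hd, hw, -⟩
  obtain rfl : w = v := hw
  rw [huniq j hd]

/-! ### Replacing every vertex by a copy of `P - none` -/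

/-- The dart of `P - none` that was joined to the `k`-th dart of `none`. -/
noncomputable def port (P : CubicDartGraph (Option Q)) (k : Fin 3) : Q × Fin 3 :=
  ((P.opp (none, k)).1.get (Option.ne_none_iff_isSome.1 (P.loopless (none, k))),
    (P.opp (none, k)).2)

lemma opp_none (P : CubicDartGraph (Option Q)) (k : Fin 3) :
    P.opp (none, k) = (some (P.port k).1, (P.port k).2) := by
  simp [port]

lemma opp_port (P : CubicDartGraph (Option Q)) (k : Fin 3) :
    P.opp (some (P.port k).1, (P.port k).2) = (none, k) := by
  rw [← opp_none, P.opp_opp]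

lemma port_fst_injective (P : CubicDartGraph (Option Q)) :
    Function.Injective fun k => (P.port k).1 := by
  intro j k hjk
  apply P.simple none
  simpa [opp_none] using hjk

lemma internal_or_port (P : CubicDartGraph (Option Q)) (q : Q) (i : Fin 3) :
    (∃ q' i', P.opp (some q, i) = (some q', i')) ∨ ∃ k, P.port k = (q, i) := by
  rcases h : P.opp (some q, i) with ⟨_ | q', i'⟩
  · right
    refine ⟨i', ?_⟩
    have := P.opp_none i'
    rw [← h, P.opp_opp] at this
    simp only [Prod.mk.injEq, Option.some.injEq] at this
    exact Prod.ext this.1.symm this.2.symm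
  · exact Or.inl ⟨q', i', rfl⟩

/-- The dart of the inflated graph that stems from a dart of the original graph. -/
noncomputable def lift (P : CubicDartGraph (Option Q)) (d : V × Fin 3) : (V × Q) × Fin 3 :=
  ((d.1, (P.port d.2).1), (P.port d.2).2)

/-- Turning around the darts of the inflated graph. -/
noncomputable def inflateOpp (G : CubicDartGraph V) (P : CubicDartGraph (Option Q))
    (d : (V × Q) × Fin 3) : (V × Q) × Fin 3 :=
  match P.opp (some d.1.2, d.2) with
  | (some q, i) => ((d.1.1, q), i)
  | (none, k) => P.lift (G.opp (d.1.1, k))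

lemma inflateOpp_internal {q i q' i'} (h : P.opp (some q, i) = (some q', i')) (v : V) :
    G.inflateOpp P ((v, q), i) = ((v, q'), i') := by
  simp [inflateOpp, h]

lemma inflateOpp_lift (d : V × Fin 3) : G.inflateOpp P (P.lift d) = P.lift (G.opp d) := by
  simp [inflateOpp, lift, opp_port]

/-- A dart of the inflated graph lies in a copy of `P - none` or stems from the original graph. -/
lemma inflate_cases {motive : (V × Q) × Fin 3 → Prop} (P : CubicDartGraph (Option Q))
    (internal : ∀ v q i q' i', P.opp (some q, i) = (some q', i') → motive ((v, q), i))
    (lift : ∀ d, motive (P.lift d)) (d) : motive d := by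
  obtain ⟨⟨v, q⟩, i⟩ := d
  rcases P.internal_or_port q i with ⟨q', i', h⟩ | ⟨k, hk⟩
  · exact internal v q i q' i' h
  · have := lift (v, k)
    simpa only [CubicDartGraph.lift, hk] using this

/-- Every vertex of `G` is replaced by a copy of `P - none`. -/
noncomputable def inflate (G : CubicDartGraph V) (P : CubicDartGraph (Option Q)) :
    CubicDartGraph (V × Q) where
  opp := G.inflateOpp P
  opp_opp := by
    refine inflate_cases P ?_ ?_
    · intro v q i q' i' h
      rw [inflateOpp_internal h, inflateOpp_internal (i' := i) (q' := q) (by rw [← h, P.opp_opp])]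
    · intro d
      rw [inflateOpp_lift, inflateOpp_lift, G.opp_opp]
  loopless := by
    refine inflate_cases P ?_ ?_
    · intro v q i q' i' h
      rw [inflateOpp_internal h]
      have := P.loopless (some q, i)
      simp_all
    · intro d
      rw [inflateOpp_lift]
      have := G.loopless d
      simp_all [lift]
  simple := by
    rintro ⟨v, q⟩ i j h
    apply P.simple (some q)
    rcases P.internal_or_port q i with ⟨q', i', hi⟩ | ⟨k, hk⟩ <;>
    rcases P.internal_or_port q j with ⟨q'', j', hj⟩ | ⟨l, hl⟩
    · rw [inflateOpp_internal hi, inflateOpp_internal hj] at h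
      simp_all
    · have e : ((v, q), j) = P.lift (v, l) := by simp [lift, hl]
      rw [e, inflateOpp_internal hi, inflateOpp_lift] at h
      exact absurd (congrArg Prod.fst h).symm (G.loopless (v, l))
    · have e : ((v, q), i) = P.lift (v, k) := by simp [lift, hk]
      rw [e, inflateOpp_internal hj, inflateOpp_lift] at h
      exact absurd (congrArg Prod.fst h) (G.loopless (v, k))
    · have h1 := P.opp_port k
      have h2 := P.opp_port l
      rw [hk] at h1
      rw [hl] at h2
      simp [h1, h2]

lemma inflate_opp_internal {q i q' i'} (h : P.opp (some q, i) = (some q', i')) (v : V) :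
    (G.inflate P).opp ((v, q), i) = ((v, q'), i') := inflateOpp_internal h v

lemma inflate_opp_lift (d : V × Fin 3) : (G.inflate P).opp (P.lift d) = P.lift (G.opp d) :=
  inflateOpp_lift d

/-! ### Inflation preserves 3-connectedness -/

lemma lift_fst_ne {d : V × Fin 3} {u : V} (h : d.1 ≠ u) (a : Q) : (P.lift d).1 ≠ (u, a) :=
  fun e => h (congrArg Prod.fst e)

lemma ThreeConnected.deleteVert_connected (hP : P.ThreeConnected) (c : Q) (T : Set Q)
    (hT : ∀ q i q' i', P.opp (some q, i) = (some q', i') → q ≠ c → q' ≠ c → q ∈ T → q' ∈ T)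
    (q q' : Q) (hq : q ≠ c) (hq' : q' ≠ c) (hqT : q ∈ T) : q' ∈ T := by
  have := hP none (some c) (some '' T) ?_ (some q) (some q')
      (by simp) (by simpa) (by simp) (by simpa) ⟨q, hqT, rfl⟩
  · simpa using this
  · rintro ⟨x, i⟩ h1 h2 h3 h4 ⟨r, hr, rfl⟩
    rcases h : P.opp (some r, i) with ⟨_ | r', i'⟩
    · simp_all
    · exact ⟨r', hT r i r' i' h (by rintro rfl; simp at h2) (by rintro rfl; simp [h] at h4) hr, rfl⟩

lemma port_fst_ne (P : CubicDartGraph (Option Q)) {j k : Fin 3} (h : j ≠ k) :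
    (P.port j).1 ≠ (P.port k).1 := fun e => h (P.port_fst_injective e)

/-- One of the three distinct ports usually serves as a further vertex `c` to delete, different from
`q` and `q'`; three ports cannot all lie in `{q, q'}`. -/
lemma ThreeConnected.deleteNone_connected (hP : P.ThreeConnected) (T : Set Q)
    (hT : ∀ q i q' i', P.opp (some q, i) = (some q', i') → q ∈ T → q' ∈ T)
    (q q' : Q) (hqT : q ∈ T) : q' ∈ T := by
  have key := fun c => hP.deleteVert_connected c T fun r i r' i' h _ _ => hT r i r' i' h
  have h01 := P.port_fst_ne (show (0 : Fin 3) ≠ 1 by decide)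
  have h02 := P.port_fst_ne (show (0 : Fin 3) ≠ 2 by decide)
  have h12 := P.port_fst_ne (show (1 : Fin 3) ≠ 2 by decide)
  by_cases hq : ∃ c, q ≠ c ∧ q' ≠ c
  · obtain ⟨c, h1, h2⟩ := hq
    exact key c q q' h1 h2 hqT
  · push Not at hq
    have h0 := hq (P.port 0).1
    have h1 := hq (P.port 1).1
    have h2 := hq (P.port 2).1
    by_cases e : q = (P.port 0).1
    · exact absurd ((h1 (e ▸ h01)).symm.trans (h2 (e ▸ h02))) h12
    · by_cases e' : q = (P.port 1).1
      · exact absurd ((h0 e).symm.trans (h2 (e' ▸ h12))) h02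
      · exact absurd ((h0 e).symm.trans (h1 e')) h01

/-- Both deleted vertices lie in the copy at `u`. The other copies are intact and are linked through
`G - u`; seen from the damaged copy they act as the single vertex `none` of `P`, so 3-connectedness
of `P` finishes. -/
lemma ThreeConnected.inflate_aux_same (hG : G.ThreeConnected) (hP : P.ThreeConnected)
    (u : V) (a b : Q) (S : Set (V × Q))
    (hS : ∀ d, d.1 ≠ (u, a) → d.1 ≠ (u, b) → ((G.inflate P).opp d).1 ≠ (u, a) →
      ((G.inflate P).opp d).1 ≠ (u, b) → (d.1 ∈ S ↔ ((G.inflate P).opp d).1 ∈ S))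
    (w₀ : V) (q₀ : Q) (hw₀ : w₀ ≠ u) (h₀ : (w₀, q₀) ∈ S) (x : V × Q)
    (hxa : x ≠ (u, a)) (hxb : x ≠ (u, b)) : x ∈ S := by
  have full : ∀ w, w ≠ u → ∀ q q', (w, q) ∈ S → (w, q') ∈ S := by
    intro w hw q q'
    refine hP.deleteNone_connected {r | (w, r) ∈ S} ?_ q q'
    intro r i r' i' h hr
    have := hS ((w, r), i)
    rw [inflate_opp_internal h] at this
    exact (this (by simp [hw]) (by simp [hw]) (by simp [hw]) (by simp [hw])).1 hr
  have out : ∀ w, w ≠ u → ∀ q, (w, q) ∈ S := by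
    intro w hw q
    refine hG u u {w | ∀ q, (w, q) ∈ S} ?_ w₀ w hw₀ hw₀ hw hw (fun r => full w₀ hw₀ q₀ r h₀) q
    rintro d h1 - h2 - hx r
    refine full _ h2 (P.port (G.opp d).2).1 r ?_
    have := hS (P.lift d)
    rw [inflate_opp_lift] at this
    exact (this (lift_fst_ne h1 _) (lift_fst_ne h1 _) (lift_fst_ne h2 _) (lift_fst_ne h2 _)).1
      (hx _)
  obtain ⟨w, q⟩ := x
  by_cases hw : w = u
  swap
  · exact out w hw q
  subst hw
  refine hP (some a) (some b) {x | ∀ q, x = some q → (w, q) ∈ S} ?_ none (some q)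
    (by simp) (by simp) (by simpa using hxa) (by simpa using hxb) (by simp) q rfl
  rintro ⟨x, i⟩ h1 h2 h3 h4 hx r hr
  rcases x with _ | x
  · obtain rfl : (P.port i).1 = r := by simpa [opp_none] using hr
    have := hS (P.lift (w, i))
    rw [inflate_opp_lift] at this
    have hne := G.loopless (w, i)
    refine (this ?_ ?_ (lift_fst_ne hne _) (lift_fst_ne hne _)).2 (out _ hne _)
    · simpa [lift, opp_none] using h3
    · simpa [lift, opp_none] using h4
  · have h5 : P.opp (some x, i) = (some r, (P.opp (some x, i)).2) := Prod.ext hr rfl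
    have := hS ((w, x), i)
    rw [inflate_opp_internal h5] at this
    simp only [hr] at h3 h4
    exact (this (by simpa using h1) (by simpa using h2) (by simpa using h3)
      (by simpa using h4)).1 (hx x rfl)

/-- Of the three ports at most one is `c` and at most one leads to `w'`. -/
lemma exists_exit (G : CubicDartGraph V) (P : CubicDartGraph (Option Q)) (w w' : V) (c : Q) :
    ∃ i, (P.port i).1 ≠ c ∧ (G.opp (w, i)).1 ≠ w' := by
  by_contra! hc
  obtain ⟨i, j, k, hij, hik, hjk⟩ : ∃ i j k : Fin 3, i ≠ j ∧ i ≠ k ∧ j ≠ k := by decide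
  have h2 := G.simple w
  by_cases hi : (P.port i).1 = c
  · have hj : (P.port j).1 ≠ c := fun h => P.port_fst_ne hij (hi.trans h.symm)
    have hk : (P.port k).1 ≠ c := fun h => P.port_fst_ne hik (hi.trans h.symm)
    exact hjk (h2 j k ((hc j hj).trans (hc k hk).symm))
  · by_cases hj : (P.port j).1 = c
    · have hk : (P.port k).1 ≠ c := fun h => P.port_fst_ne hjk (hj.trans h.symm)
      exact hik (h2 i k ((hc i hi).trans (hc k hk).symm))
    · exact hij (h2 i j ((hc i hi).trans (hc j hj).symm))

/-- Each copy loses at most one vertex and stays connected, so membership in `S` is a property `T`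
of copies. Copies away from `u` and `v` are linked through `G - u - v`, and each damaged copy has an
intact edge to one of them by `exists_exit`. -/
lemma ThreeConnected.inflate_aux_ne (hG : G.ThreeConnected) (hP : P.ThreeConnected)
    (u v : V) (a b : Q) (huv : u ≠ v) (S : Set (V × Q))
    (hS : ∀ d, d.1 ≠ (u, a) → d.1 ≠ (v, b) → ((G.inflate P).opp d).1 ≠ (u, a) →
      ((G.inflate P).opp d).1 ≠ (v, b) → (d.1 ∈ S ↔ ((G.inflate P).opp d).1 ∈ S))
    (x y : V × Q) (hxa : x ≠ (u, a)) (hxb : x ≠ (v, b)) (hya : y ≠ (u, a)) (hyb : y ≠ (v, b))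
    (hx : x ∈ S) : y ∈ S := by
  have full : ∀ w, ∃ T : Prop, ∀ q, (w, q) ≠ (u, a) → (w, q) ≠ (v, b) → ((w, q) ∈ S ↔ T) := by
    intro w
    have step : ∀ r i r' i', P.opp (some r, i) = (some r', i') → (w, r) ≠ (u, a) →
        (w, r) ≠ (v, b) → (w, r') ≠ (u, a) → (w, r') ≠ (v, b) → (w, r) ∈ S → (w, r') ∈ S := by
      intro r i r' i' h h1 h2 h3 h4 hr
      have := hS ((w, r), i)
      rw [inflate_opp_internal h] at this
      exact (this h1 h2 h3 h4).1 hr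
    have aux : ∀ c, (∀ q, q ≠ c → (w, q) ≠ (u, a) ∧ (w, q) ≠ (v, b)) →
        ∃ T : Prop, ∀ q, q ≠ c → ((w, q) ∈ S ↔ T) := by
      intro c hc
      refine ⟨∃ q, q ≠ c ∧ (w, q) ∈ S, fun q hq => ⟨fun h => ⟨q, hq, h⟩, ?_⟩⟩
      rintro ⟨r, hr, h⟩
      refine hP.deleteVert_connected c {r | (w, r) ∈ S} ?_ r q hr hq h
      intro r i r' i' h h1 h2
      exact step r i r' i' h (hc r h1).1 (hc r h1).2 (hc r' h2).1 (hc r' h2).2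
    by_cases hwu : w = u
    · subst hwu
      obtain ⟨T, hT⟩ := aux a (by simp [huv])
      exact ⟨T, fun q h1 _ => hT q (by simpa using h1)⟩
    by_cases hwv : w = v
    · subst hwv
      obtain ⟨T, hT⟩ := aux b (by simp [hwu])
      exact ⟨T, fun q _ h1 => hT q (by simpa using h1)⟩
    refine ⟨∃ q, (w, q) ∈ S, fun q _ _ => ⟨fun h => ⟨q, h⟩, ?_⟩⟩
    rintro ⟨r, h⟩
    refine hP.deleteNone_connected {r | (w, r) ∈ S} ?_ r q h
    intro r i r' i' h
    exact step r i r' i' h (by simp [hwu]) (by simp [hwv]) (by simp [hwu]) (by simp [hwv])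
  choose T hT using full
  have step : ∀ d, (P.lift d).1 ≠ (u, a) → (P.lift d).1 ≠ (v, b) →
      (P.lift (G.opp d)).1 ≠ (u, a) → (P.lift (G.opp d)).1 ≠ (v, b) →
      (T d.1 ↔ T (G.opp d).1) := by
    intro d h1 h2 h3 h4
    have := hS (P.lift d)
    rw [inflate_opp_lift] at this
    exact (hT _ _ h1 h2).symm.trans ((this h1 h2 h3 h4).trans (hT _ _ h3 h4))
  have out : ∀ w w', w ≠ u → w ≠ v → w' ≠ u → w' ≠ v → T w → T w' := by
    intro w w'
    refine hG u v {w | T w} ?_ w w'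
    intro d h1 h2 h3 h4 h5
    exact (step d (lift_fst_ne h1 _) (lift_fst_ne h2 _) (lift_fst_ne h3 _) (lift_fst_ne h4 _)).1 h5
  have key : ∀ w, ∃ w', w' ≠ u ∧ w' ≠ v ∧ (T w ↔ T w') := by
    intro w
    by_cases hwu : w = u
    · subst hwu
      obtain ⟨i, h1, h2⟩ := exists_exit G P w v a
      have hne := G.loopless (w, i)
      exact ⟨_, hne, h2, step (w, i) (by simp [lift, h1]) (lift_fst_ne huv _)
        (lift_fst_ne hne _) (lift_fst_ne h2 _)⟩
    by_cases hwv : w = v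
    · subst hwv
      obtain ⟨i, h1, h2⟩ := exists_exit G P w u b
      have hne := G.loopless (w, i)
      exact ⟨_, h2, hne, step (w, i) (lift_fst_ne hwu _) (by simp [lift, h1])
        (lift_fst_ne h2 _) (lift_fst_ne hne _)⟩
    exact ⟨w, hwu, hwv, Iff.rfl⟩
  obtain ⟨w, q⟩ := x
  obtain ⟨w', q'⟩ := y
  obtain ⟨x, a1, a2, a3⟩ := key w
  obtain ⟨x', b1, b2, b3⟩ := key w'
  exact (hT w' q' hya hyb).2 (b3.2 (out x x' a1 a2 b1 b2 (a3.1 ((hT w q hxa hxb).1 hx))))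

theorem ThreeConnected.inflate (hG : G.ThreeConnected) (hP : P.ThreeConnected) :
    (G.inflate P).ThreeConnected := by
  rintro ⟨u, a⟩ ⟨v, b⟩ S hS x y hxa hxb hya hyb hx
  have hS' : ∀ d, d.1 ≠ (u, a) → d.1 ≠ (v, b) → ((G.inflate P).opp d).1 ≠ (u, a) →
      ((G.inflate P).opp d).1 ≠ (v, b) → (d.1 ∈ S ↔ ((G.inflate P).opp d).1 ∈ S) := by
    refine fun d h1 h2 h3 h4 => ⟨hS d h1 h2 h3 h4, fun h5 => ?_⟩
    have := hS _ h3 h4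
    rw [(G.inflate P).opp_opp] at this
    exact this h1 h2 h5
  by_cases huv : u = v
  · subst huv
    by_cases h₀ : ((G.opp (u, 0)).1, a) ∈ S
    · exact hG.inflate_aux_same hP u a b S hS' _ a (G.loopless _) h₀ y hya hyb
    · refine absurd hx (hG.inflate_aux_same hP u a b Sᶜ ?_ _ a (G.loopless (u, 0)) h₀ x hxa hxb)
      exact fun d h1 h2 h3 h4 => not_congr (hS' d h1 h2 h3 h4)
  · exact hG.inflate_aux_ne hP u v a b huv S hS' x y hxa hxb hya hyb hx

/-! ### Bridgeless spanning subgraphs with even components under inflation -/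

/-- A set containing `none` may be replaced by its complement: a cut is the same from both sides,
and `Option Q` has even size, so the parities agree. -/
lemma EvenBridgeless.of_notMem_none [Finite Q] (hQ : Odd (Nat.card Q))
    {h : Option Q × Fin 3 → Prop} (symm : ∀ d, h d → h (P.opp d))
    (bridgeless : ∀ T : Set Q, ¬ ∃! d, h d ∧ d.1 ∈ some '' T ∧ (P.opp d).1 ∉ some '' T)
    (even : ∀ T : Set Q, (∀ d, h d → d.1 ∈ some '' T → (P.opp d).1 ∈ some '' T) → Even T.ncard) :
    P.EvenBridgeless h := by
  have image : ∀ S : Set (Option Q), none ∉ S → S = some '' (some ⁻¹' S) := by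
    intro S hS
    ext (_ | x) <;> simp [hS]
  refine ⟨symm, fun S => ?_, fun S => ?_⟩
  · by_cases hS : none ∈ S
    · rintro ⟨d, ⟨h1, h2, h3⟩, h4⟩
      refine bridgeless (some ⁻¹' Sᶜ) ⟨P.opp d, ?_, ?_⟩
      · dsimp only
        rw [← image Sᶜ (by simpa using hS), P.opp_opp]
        exact ⟨symm d h1, h3, by simpa using h2⟩
      · rintro e ⟨h5, h6, h7⟩
        rw [← image Sᶜ (by simpa using hS)] at h6 h7
        rw [← h4 (P.opp e) ⟨symm e h5, by simpa using h7, by simpa [P.opp_opp] using h6⟩, P.opp_opp]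
    · rw [image S hS]
      exact bridgeless _
  · intro hcl
    by_cases hS : none ∈ S
    · have h1 : Even (some ⁻¹' Sᶜ : Set Q).ncard := by
        refine even _ ?_
        rw [← image Sᶜ (by simpa using hS)]
        intro d h1 h2 h3
        have := hcl _ (symm d h1) h3
        rw [P.opp_opp] at this
        exact h2 this
      have h2 : Sᶜ.ncard = (some ⁻¹' Sᶜ : Set Q).ncard := by
        conv_lhs => rw [image Sᶜ (by simpa using hS)]
        exact Set.ncard_image_of_injective _ (Option.some_injective _)
      have h3 := Set.ncard_add_ncard_compl S
      rw [Finite.card_option, h2] at h3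
      have h4 : Even (Nat.card Q + 1) := hQ.add_one
      rw [← h3] at h4
      exact (Nat.even_add.1 h4).2 h1
    · rw [image S hS, Set.ncard_image_of_injective _ (Option.some_injective _)]
      exact even _ (by rw [← image S hS]; exact hcl)

/-- The darts of `P` that correspond to the darts of `h` in the copy of `P - none` at `v`. -/
def localDarts (P : CubicDartGraph (Option Q)) (h : (V × Q) × Fin 3 → Prop) (v : V)
    (d : Option Q × Fin 3) : Prop :=
  match d.1 with
  | some q => h ((v, q), d.2)
  | none => h (P.lift (v, d.2))

lemma crossing_iff (v w : V) (q : Q) (i : Fin 3) (T : Set Q) :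
    ((w, q) ∈ Prod.mk v '' T ∧ ((G.inflate P).opp ((w, q), i)).1 ∉ Prod.mk v '' T) ↔
      w = v ∧ some q ∈ some '' T ∧ (P.opp (some q, i)).1 ∉ some '' T := by
  rcases P.internal_or_port q i with ⟨q', i', h⟩ | ⟨k, hk⟩
  · rw [inflate_opp_internal h, h]
    simp only [Set.mem_image, Prod.mk.injEq, Option.some.injEq]
    grind
  · have e : ((w, q), i) = P.lift (w, k) := by simp [lift, hk]
    have e' := P.opp_port k
    rw [hk] at e'
    have hne := G.loopless (w, k)
    rw [e, inflate_opp_lift, e']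
    simp only [Set.mem_image, Prod.mk.injEq, Option.some.injEq, lift]
    grind

lemma EvenBridgeless.localDarts [Finite Q] (hQ : Odd (Nat.card Q)) {h : (V × Q) × Fin 3 → Prop}
    (hh : (G.inflate P).EvenBridgeless h) (v : V) : P.EvenBridgeless (P.localDarts h v) := by
  refine .of_notMem_none hQ ?_ ?_ ?_
  · rintro ⟨_ | q, i⟩ hd
    · rw [opp_none]
      exact hd
    · rcases P.internal_or_port q i with ⟨q', i', he⟩ | ⟨k, hk⟩
      · rw [he]
        have := hh.symm _ hd
        rwa [inflate_opp_internal he] at this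
      · have e := P.opp_port k
        rw [hk] at e
        rw [e]
        simpa [CubicDartGraph.localDarts, lift, hk] using hd
  · rintro T ⟨⟨x, i⟩, ⟨h1, h2, h3⟩, h4⟩
    obtain ⟨q, hq, rfl⟩ := h2
    refine hh.bridgeless (Prod.mk v '' T) ⟨((v, q), i), ?_, ?_⟩
    · exact ⟨h1, (crossing_iff v v q i T).2 ⟨rfl, ⟨q, hq, rfl⟩, h3⟩⟩
    · rintro ⟨⟨w, r⟩, j⟩ ⟨h5, h6⟩
      obtain ⟨rfl, h7, h8⟩ := (crossing_iff v w r j T).1 h6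
      have := h4 (some r, j) ⟨h5, h7, h8⟩
      simp_all
  · intro T hT
    rw [← Set.ncard_image_of_injective T (Prod.mk_right_injective v)]
    refine hh.even _ ?_
    rintro ⟨⟨w, r⟩, j⟩ h5 h6
    by_contra h7
    obtain ⟨rfl, h8, h9⟩ := (crossing_iff v w r j T).1 ⟨h6, h7⟩
    exact h9 (hT (some r, j) h5 h8)

/-- A set of vertices of `G` and its preimage have the same parity, since each copy is odd. -/
lemma EvenBridgeless.contract [Finite Q] (hQ : Odd (Nat.card Q)) {h : (V × Q) × Fin 3 → Prop}
    (hh : (G.inflate P).EvenBridgeless h) : G.EvenBridgeless fun d => h (P.lift d) := by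
  refine ⟨fun d hd => ?_, ?_, ?_⟩
  · have := hh.symm _ hd
    rwa [inflate_opp_lift] at this
  · rintro S ⟨d, ⟨h1, h2, h3⟩, h4⟩
    refine hh.bridgeless (Prod.fst ⁻¹' S) ⟨P.lift d, ⟨h1, h2, ?_⟩, ?_⟩
    · rw [inflate_opp_lift]
      exact h3
    · refine inflate_cases P ?_ ?_
      · rintro v q i q' i' he ⟨-, h5, h6⟩
        rw [inflate_opp_internal he] at h6
        exact absurd h5 h6
      · rintro e ⟨h5, h6, h7⟩
        rw [inflate_opp_lift] at h7
        rw [h4 e ⟨h5, h6, h7⟩]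
  · intro S hS
    have := hh.even (Prod.fst ⁻¹' S) ?_
    · rw [show (Prod.fst ⁻¹' S : Set (V × Q)) = S ×ˢ Set.univ by ext; simp, Set.ncard_prod,
        Set.ncard_univ] at this
      exact (Nat.even_mul.1 this).resolve_right (Nat.not_even_iff_odd.2 hQ)
    · refine inflate_cases P ?_ ?_
      · intro v q i q' i' he _ h5
        rw [inflate_opp_internal he]
        exact h5
      · intro d h5 h6
        rw [inflate_opp_lift]
        exact hS d h5 h6

/-- At most three edges of `h` leave `none`, so one of `T` and its complement receives at most one
of them. That edge would be a bridge; without it the side is closed under `h` in `P` and misses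
`none`, hence is empty. -/
lemma EvenConnected.deleteNone (hP : P.EvenConnected) {h : Option Q × Fin 3 → Prop}
    (hh : P.EvenBridgeless h) (T : Set Q)
    (hT : ∀ q i q' i', P.opp (some q, i) = (some q', i') → h (some q, i) → q ∈ T → q' ∈ T) :
    T = ∅ ∨ T = Set.univ := by
  have hT' : ∀ q i q' i', P.opp (some q, i) = (some q', i') → h (some q, i) → q ∉ T → q' ∉ T := by
    intro q i q' i' he hd hq hq'
    have e : P.opp (some q', i') = (some q, i) := by rw [← he, P.opp_opp]
    exact hq (hT q' i' q i e (by rw [← he]; exact hh.symm _ hd) hq')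
  have aux : ∀ T : Set Q,
      (∀ q i q' i', P.opp (some q, i) = (some q', i') → h (some q, i) → q ∈ T → q' ∈ T) →
      (∃ k, ∀ j, h (none, j) → (P.port j).1 ∈ T → j = k) → T = ∅ := by
    rintro T hT ⟨k, hk⟩
    have leave : ∀ d, h d → d.1 ∈ some '' T → (P.opp d).1 ∉ some '' T →
        d = P.opp (none, k) ∧ h (none, k) ∧ (P.port k).1 ∈ T := by
      rintro ⟨_, i⟩ h1 ⟨q, hq, rfl⟩ h3
      rcases P.internal_or_port q i with ⟨q', i', he⟩ | ⟨j, hj⟩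
      · rw [he] at h3
        exact absurd ⟨q', hT q i q' i' he h1 hq, rfl⟩ h3
      · have e := P.opp_port j
        rw [hj] at e
        have h4 := hh.symm _ h1
        rw [e] at h4
        have h5 : (P.port j).1 ∈ T := by rw [hj]; exact hq
        obtain rfl := hk j h4 h5
        exact ⟨by rw [← e, P.opp_opp], h4, h5⟩
    have closed : ∀ d, h d → d.1 ∈ some '' T → (P.opp d).1 ∈ some '' T := by
      intro d h1 h2
      by_contra h3
      obtain ⟨h4, h5, h6⟩ := leave d h1 h2 h3
      exact hh.bridgeless (some '' T) ⟨d, ⟨h1, h2, h3⟩, fun e he =>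
        (leave e he.1 he.2.1 he.2.2).1.trans h4.symm⟩
    rcases hP h hh _ closed with h1 | h1
    · simpa using h1
    · have : none ∈ some '' T := h1 ▸ Set.mem_univ _
      simp at this
  obtain ⟨k, hk⟩ : ∃ k, (∀ j, h (none, j) → (P.port j).1 ∈ T → j = k) ∨
      (∀ j, h (none, j) → (P.port j).1 ∈ Tᶜ → j = k) := by
    have : ∀ f : Fin 3 → Bool, ∃ k, (∀ j, f j = true → j = k) ∨ (∀ j, f j = false → j = k) := by
      decide
    classical
    obtain ⟨k, hk⟩ := this fun j => decide ((P.port j).1 ∈ T)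
    exact ⟨k, hk.imp (fun H j _ hj => H j (by simpa using hj)) fun H j _ hj => H j (by simpa using hj)⟩
  rcases hk with hk | hk
  · exact Or.inl (aux T hT ⟨k, hk⟩)
  · exact Or.inr (Set.compl_empty_iff.1 (aux Tᶜ hT' ⟨k, hk⟩))

lemma EvenBridgeless.piece_connected [Finite Q] (hQ : Odd (Nat.card Q)) (hP : P.EvenConnected)
    {h : (V × Q) × Fin 3 → Prop} (hh : (G.inflate P).EvenBridgeless h) (v : V) (T : Set Q)
    (hT : ∀ q i q' i', (G.inflate P).opp ((v, q), i) = ((v, q'), i') → h ((v, q), i) →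
      q ∈ T → q' ∈ T) : T = ∅ ∨ T = Set.univ :=
  hP.deleteNone (hh.localDarts hQ v) T fun q i q' i' he =>
    hT q i q' i' (inflate_opp_internal he v)

theorem EvenConnected.inflate [Finite Q] (hQ : Odd (Nat.card Q)) (hG : G.EvenConnected)
    (hP : P.EvenConnected) : (G.inflate P).EvenConnected := by
  intro h hh S hS
  have piece : ∀ v, (∀ q, (v, q) ∉ S) ∨ ∀ q, (v, q) ∈ S := by
    intro v
    refine (hh.piece_connected hQ hP v {q | (v, q) ∈ S} ?_).imp
      (fun H q hq => ?_) (fun H q => ?_)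
    · intro q i q' i' he hd hq
      have := hS _ hd hq
      rwa [he] at this
    · exact (H ▸ hq : q ∈ (∅ : Set Q))
    · exact (H ▸ Set.mem_univ q : q ∈ {q | (v, q) ∈ S})
  obtain ⟨q₀⟩ : Nonempty Q := ⟨(P.port 0).1⟩
  have mem : ∀ v q, (v, q) ∈ S ↔ (v, q₀) ∈ S := by
    intro v q
    rcases piece v with h1 | h1 <;> simp [h1]
  have closed : ∀ d, h (P.lift d) → d.1 ∈ {v | (v, q₀) ∈ S} → (G.opp d).1 ∈ {v | (v, q₀) ∈ S} := by
    intro d hd h2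
    have := hS _ hd ((mem _ _).2 h2)
    rw [inflate_opp_lift] at this
    exact (mem _ _).1 this
  refine (hG _ (hh.contract hQ) _ closed).imp (fun h1 => ?_) (fun h1 => ?_)
  all_goals
    ext ⟨v, q⟩
    rw [mem]
    simpa using (Set.ext_iff.1 h1 v)

/-- Without a vertex of degree three the copy would have all degrees two, and `OddFactor` would give
an odd component. -/
lemma EvenBridgeless.exists_branch [Finite Q] (hQ : Odd (Nat.card Q)) (hP : P.OddFactor)
    {h : (V × Q) × Fin 3 → Prop} (hh : (G.inflate P).EvenBridgeless h) (v : V) :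
    ∃ q, ∀ i, h ((v, q), i) := by
  by_contra! hc
  have hl := hh.localDarts hQ v
  obtain ⟨S, hS, hodd, hcl⟩ := hP _ hl.symm (by
    intro q
    obtain ⟨i, hi⟩ := hl.two_le_degree (some q)
    obtain ⟨j, hj⟩ := hc q
    refine ⟨i, fun h1 => hj ?_, hi⟩
    by_cases hji : j = i
    · exact hji ▸ h1
    · exact hi j hji)
  exact Nat.not_even_iff_odd.2 hodd (hl.even S hcl)

/-! ### Distance from closed trails -/

/-- A cycle modulo two meets every cut evenly. With the outside of the copy contracted to `none`,
each edge is counted by two darts, and all vertices but `none` already contribute zero. -/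
lemma sum_lift_eq_zero [Fintype Q] {D : (V × Q) × Fin 3 → ZMod 2}
    (hD : ∀ d, D ((G.inflate P).opp d) = D d) (hdeg : ∀ x, ∑ i, D (x, i) = 0) (v : V) :
    ∑ k, D (P.lift (v, k)) = 0 := by
  let D' : Option Q × Fin 3 → ZMod 2 := fun d =>
    match d.1 with
    | some q => D ((v, q), d.2)
    | none => D (P.lift (v, d.2))
  have hD' : ∀ d, D' (P.opp d) = D' d := by
    rintro ⟨_ | q, i⟩
    · rw [opp_none]
      rfl
    · rcases P.internal_or_port q i with ⟨q', i', he⟩ | ⟨k, hk⟩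
      · rw [he]
        have := hD ((v, q), i)
        rwa [inflate_opp_internal he] at this
      · have e := P.opp_port k
        rw [hk] at e
        rw [e]
        simp [D', lift, hk]
  have hsum : ∑ d, D' d = 0 := by
    refine Finset.sum_involution (fun d _ => P.opp d) ?_ ?_ ?_ ?_
    · intro d _
      rw [hD' d]
      exact CharTwo.add_self_eq_zero _
    · intro d _ _ he
      exact P.loopless d (congrArg Prod.fst he)
    · simp
    · intro d _
      exact P.opp_opp d
  rw [Fintype.sum_prod_type, Fintype.sum_option] at hsum
  simpa [D', hdeg] using hsum

/-- The function for the contracted trail is raised by one at the single vertex `(v, q₀)`. As `q₀`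
is not a port, its neighbours all lie in the same copy, where the old function is constant; `0 < n`
ensures that the trail misses this copy. -/
lemma Far.inflate [Fintype Q] {n : ℕ} (hn : 0 < n) (hG : G.Far n) (q₀ : Q)
    (hq₀ : ∀ k, (P.port k).1 ≠ q₀) : (G.inflate P).Far (n + 1) := by
  classical
  intro D U hD hdeg hconn
  obtain ⟨f, h1, h2, v, h3⟩ := hG (fun d => D (P.lift d)) (Prod.fst '' U)
    (fun d => by rw [← inflate_opp_lift (G := G), hD]) (sum_lift_eq_zero hD hdeg) (by
      rintro S hS _ ⟨x, hx, rfl⟩ _ ⟨y, hy, rfl⟩ hxS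
      refine hconn (Prod.fst ⁻¹' S) ?_ x hx y hy hxS
      refine inflate_cases P ?_ ?_
      · intro v q i q' i' he _ h5
        rw [inflate_opp_internal he]
        exact h5
      · intro d h5 h6
        rw [inflate_opp_lift]
        exact hS d h5 h6)
  refine ⟨fun x => f x.1 + if x = (v, q₀) then 1 else 0, ?_, ?_, (v, q₀), by simpa using h3⟩
  · refine inflate_cases P ?_ ?_
    · intro v q i q' i' he
      rw [inflate_opp_internal he]
      dsimp only
      split_ifs <;> omega
    · intro d
      rw [inflate_opp_lift]
      have e : ∀ d : V × Fin 3, (P.lift d).1 ≠ (v, q₀) := fun d e => hq₀ d.2 (congrArg Prod.snd e)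
      simp only [if_neg (e _)]
      exact h1 d
  · intro u hu
    have h4 := h2 u.1 ⟨u, hu, rfl⟩
    dsimp only
    rw [h4, if_neg]
    rintro rfl
    simp only at h4
    omega

/-- A closed trail through all vertices would have degree two everywhere, and the odd component
avoiding `none` would disconnect it. Any missed vertex is at distance at least one. -/
lemma OddFactor.far (hP : P.OddFactor) : P.Far 1 := by
  classical
  intro D U hD hdeg hconn
  by_cases hU : U = Set.univ
  · subst hU
    exfalso
    have nz : ∀ v, ∃ i, D (v, i) ≠ 0 := by
      intro v
      by_contra! hc
      have : ∃ w, w ≠ v := ⟨_, P.loopless (v, 0)⟩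
      obtain ⟨w, hw⟩ := this
      refine hw (hconn {v} ?_ v trivial w trivial rfl)
      rintro ⟨x, i⟩ h1 h2
      obtain rfl : x = v := h2
      exact absurd (hc i) h1
    obtain ⟨S, hS, hodd, hcl⟩ := hP (fun d => D d ≠ 0) (fun d hd => by rwa [hD]) (by
      intro q
      have h1 := hdeg (some q)
      have h2 := nz (some q)
      have : ∀ f : Fin 3 → ZMod 2, ∑ i, f i = 0 → (∃ i, f i ≠ 0) →
        ∃ i, ¬ f i ≠ 0 ∧ ∀ j ≠ i, f j ≠ 0 := by decide
      exact this (fun i => D (some q, i)) h1 h2)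
    obtain ⟨x, hx⟩ : S.Nonempty := by
      rw [Set.nonempty_iff_ne_empty]
      rintro rfl
      simp at hodd
    exact hS (hconn S hcl x trivial none trivial hx)
  · obtain ⟨v, hv⟩ := (Set.ne_univ_iff_exists_notMem U).1 hU
    refine ⟨fun x => if x = v then 1 else 0, fun d => ?_, fun u hu => ?_, v, by simp⟩
    · dsimp only
      split_ifs <;> omega
    · dsimp only
      rw [if_neg]
      rintro rfl
      exact hv hu

end CubicDartGraph

/-! ### The Petersen graph and its iterated inflations -/

namespace CubicDartGraph

/-- The Petersen graph: `none` is joined to `0, 1, 2`, the vertices `3, …, 8` form a hexagon, and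
each of `0, 1, 2` is joined to two opposite vertices of the hexagon. -/
def petersen : CubicDartGraph (Option (Fin 9)) where
  opp d := match d.1 with
    | none => (some (d.2.castLE (by decide)), 0)
    | some q => (![![(none, 0), (some 3, 2), (some 6, 2)], ![(none, 1), (some 4, 2), (some 7, 2)],
        ![(none, 2), (some 5, 2), (some 8, 2)],
        ![(some 4, 1), (some 8, 0), (some 0, 1)], ![(some 5, 1), (some 3, 0), (some 1, 1)],
        ![(some 6, 1), (some 4, 0), (some 2, 1)], ![(some 7, 1), (some 5, 0), (some 0, 2)],
        ![(some 8, 1), (some 6, 0), (some 1, 2)], ![(some 3, 1), (some 7, 0), (some 2, 2)]] :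
        Fin 9 → Fin 3 → Option (Fin 9) × Fin 3) q d.2
  opp_opp := by decide +kernel
  loopless := by decide +kernel
  simple := by decide +kernel

/-- `y` is reached from `r` by at most `n` steps that avoid `a` and `b`. -/
def petersenReach (a b r : Option (Fin 9)) : ℕ → Option (Fin 9) → Bool
  | 0, y => decide (y = r)
  | n + 1, y => decide (y = r) || decide (∃ i : Fin 3, (petersen.opp (y, i)).1 ≠ a ∧
      (petersen.opp (y, i)).1 ≠ b ∧ petersenReach a b r n (petersen.opp (y, i)).1 = true)

lemma exists_petersenReach : ∀ a b, ∃ r, ∀ y, y ≠ a → y ≠ b → petersenReach a b r 5 y = true := by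
  decide +kernel

theorem petersen_threeConnected : petersen.ThreeConnected := by
  intro a b S hS x y hxa hxb hya hyb hx
  obtain ⟨r, hr⟩ := exists_petersenReach a b
  have hS' : ∀ d, d.1 ≠ a → d.1 ≠ b → (petersen.opp d).1 ≠ a → (petersen.opp d).1 ≠ b →
      (d.1 ∈ S ↔ (petersen.opp d).1 ∈ S) := by
    refine fun d h1 h2 h3 h4 => ⟨hS d h1 h2 h3 h4, fun h5 => ?_⟩
    have := hS _ h3 h4
    rw [petersen.opp_opp] at this
    exact this h1 h2 h5
  have key : ∀ n y, y ≠ a → y ≠ b → petersenReach a b r n y = true → (y ∈ S ↔ r ∈ S) := by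
    intro n
    induction n with
    | zero =>
      intro y _ _ h
      simp only [petersenReach, decide_eq_true_eq] at h
      rw [h]
    | succ n ih =>
      intro y h1 h2 h
      simp only [petersenReach, Bool.or_eq_true, decide_eq_true_eq] at h
      rcases h with rfl | ⟨i, h3, h4, h5⟩
      · rfl
      · exact (hS' (y, i) h1 h2 h3 h4).trans (ih _ h3 h4 h5)
  exact (key 5 y hya hyb (hr y hya hyb)).2 ((key 5 x hxa hxb (hr x hxa hxb)).1 hx)

/-- The function on the vertices of the Petersen graph with the given values. -/
def vertexFun (t : Bool) (t0 t1 t2 t3 t4 t5 t6 t7 t8 : Bool) (x : Option (Fin 9)) : Bool :=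
  match x with
  | none => t
  | some q => (![t0, t1, t2, t3, t4, t5, t6, t7, t8] : Fin 9 → Bool) q

lemma eq_vertexFun (f : Option (Fin 9) → Bool) : f = vertexFun (f none) (f (some 0)) (f (some 1))
    (f (some 2)) (f (some 3)) (f (some 4)) (f (some 5)) (f (some 6)) (f (some 7)) (f (some 8)) := by
  funext x
  rcases x with _ | q
  · rfl
  · fin_cases q <;> rfl

/-- There is no partition of the vertices into two nonempty sets of even size that both induce
subgraphs of minimum degree two. -/
lemma petersen_cut (f : Option (Fin 9) → Bool)
    (hf : ∀ x, ∃ i, ∀ j ≠ i, f (petersen.opp (x, j)).1 = f x)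
    (heven : Even (Finset.univ.filter fun x => f x = true).card) : ∀ x y, f x = f y := by
  -- By girth five both parts would have at least five, hence exactly five, vertices. The check runs
  -- over the ten Boolean values.
  have : ∀ t t0 t1 t2 t3 t4 t5 t6 t7 t8, let f := vertexFun t t0 t1 t2 t3 t4 t5 t6 t7 t8
      (∀ x, ∃ i, ∀ j ≠ i, f (petersen.opp (x, j)).1 = f x) →
      Even (Finset.univ.filter fun x => f x = true).card → ∀ x y, f x = f y := by
    decide +kernel
  rw [eq_vertexFun f] at hf heven ⊢
  exact this _ _ _ _ _ _ _ _ _ _ hf heven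

theorem petersen_evenConnected : petersen.EvenConnected := by
  classical
  intro h hh S hS
  have hS' : ∀ d, h d → ((petersen.opp d).1 ∈ S ↔ d.1 ∈ S) := by
    refine fun d hd => ⟨fun h1 => ?_, hS d hd⟩
    have := hS _ (hh.symm d hd) h1
    rwa [petersen.opp_opp] at this
  have key := petersen_cut (fun x => decide (x ∈ S)) (by
    intro x
    obtain ⟨i, hi⟩ := hh.two_le_degree x
    exact ⟨i, fun j hj => by simpa using hS' _ (hi j hj)⟩) (by
    have := hh.even S hS
    rw [Set.ncard_eq_toFinset_card'] at this
    convert this using 2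
    ext
    simp)
  by_cases h0 : none ∈ S
  · right
    ext x
    have := key x none
    simp_all
  · left
    ext x
    have := key x none
    simp_all

/-- The function on the darts of the Petersen graph with the given values on its edges. -/
def edgeFun (e0 e1 e2 s0 s1 s2 s3 s4 s5 c0 c1 c2 c3 c4 c5 : Bool) (d : Option (Fin 9) × Fin 3) :
    Bool :=
  match d.1 with
  | none => (![e0, e1, e2] : Fin 3 → Bool) d.2
  | some q => (![![e0, s0, s3], ![e1, s1, s4], ![e2, s2, s5], ![c0, c5, s0], ![c1, c0, s1],
      ![c2, c1, s2], ![c3, c2, s3], ![c4, c3, s4], ![c5, c4, s5]] : Fin 9 → Fin 3 → Bool) q d.2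

/-- Exactly two of three. -/
def exactlyTwo (a b c : Bool) : Bool := (a && b && !c) || (a && !b && c) || (!a && b && c)

/-- The pentagons of the Petersen graph that avoid `none`, and the complement of `none`. -/
def oddSet (i : Fin 7) : Finset (Option (Fin 9)) :=
  (![{some 0, some 3, some 4, some 5, some 6}, {some 1, some 4, some 5, some 6, some 7},
    {some 2, some 5, some 6, some 7, some 8}, {some 0, some 6, some 7, some 8, some 3},
    {some 1, some 7, some 8, some 3, some 4}, {some 2, some 8, some 3, some 4, some 5},
    Finset.univ.erase none] :
    Fin 7 → Finset (Option (Fin 9))) i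

/-- The degree sum makes the degree of `none` even. If it is two, the subgraph is a 2-factor, thus
two pentagons; if it is zero, the complement of `none` is closed. The degree conditions are
interleaved with the quantifiers so that the enumeration is pruned early. -/
lemma exists_oddSet : ∀ c5 c0 s0, exactlyTwo c0 c5 s0 = true → ∀ c1 s1,
    exactlyTwo c1 c0 s1 = true → ∀ c2 s2, exactlyTwo c2 c1 s2 = true → ∀ c3 s3,
    exactlyTwo c3 c2 s3 = true → ∀ c4 s4, exactlyTwo c4 c3 s4 = true → ∀ s5,
    exactlyTwo c5 c4 s5 = true → ∀ e0, exactlyTwo e0 s0 s3 = true → ∀ e1,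
    exactlyTwo e1 s1 s4 = true → ∀ e2, exactlyTwo e2 s2 s5 = true →
    ∃ i, ∀ d : Option (Fin 9) × Fin 3, edgeFun e0 e1 e2 s0 s1 s2 s3 s4 s5 c0 c1 c2 c3 c4 c5 d →
      d.1 ∈ oddSet i → (petersen.opp d).1 ∈ oddSet i := by
  decide +kernel

lemma eq_edgeFun (f : Option (Fin 9) × Fin 3 → Bool) (hf : ∀ d, f (petersen.opp d) = f d) :
    f = edgeFun (f (some 0, 0)) (f (some 1, 0)) (f (some 2, 0)) (f (some 3, 2)) (f (some 4, 2))
      (f (some 5, 2)) (f (some 6, 2)) (f (some 7, 2)) (f (some 8, 2)) (f (some 3, 0))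
      (f (some 4, 0)) (f (some 5, 0)) (f (some 6, 0)) (f (some 7, 0)) (f (some 8, 0)) := by
  funext d
  obtain ⟨_ | q, i⟩ := d
  · fin_cases i
    · exact (hf (none, 0)).symm
    · exact (hf (none, 1)).symm
    · exact (hf (none, 2)).symm
  · fin_cases q <;> fin_cases i <;> first | rfl | exact hf (_, _) | exact (hf (_, _)).symm

theorem petersen_oddFactor : petersen.OddFactor := by
  classical
  intro h hsymm hdeg
  let f : Option (Fin 9) × Fin 3 → Bool := fun d => decide (h d)
  have hf : ∀ d, f (petersen.opp d) = f d := by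
    intro d
    have h1 := hsymm (petersen.opp d)
    rw [petersen.opp_opp] at h1
    exact decide_eq_decide.2 ⟨h1, hsymm d⟩
  have two : ∀ q, exactlyTwo (f (some q, 0)) (f (some q, 1)) (f (some q, 2)) = true := by
    intro q
    obtain ⟨i, hi, hj⟩ := hdeg q
    have aux : ∀ g : Fin 3 → Bool, (∃ i, ¬ g i = true ∧ ∀ j ≠ i, g j = true) →
        exactlyTwo (g 0) (g 1) (g 2) = true := by decide
    exact aux (fun i => f (some q, i)) ⟨i, by simpa [f] using hi, fun j hji => by simpa [f] using hj j hji⟩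
  have e := eq_edgeFun f hf
  rw [e] at two
  obtain ⟨i, hi⟩ := exists_oddSet _ _ _ (two 3) _ _ (two 4) _ _ (two 5) _ _ (two 6) _ _
    (two 7) _ (two 8) _ (two 0) _ (two 1) _ (two 2)
  refine ⟨oddSet i, ?_, ?_, ?_⟩
  · have : ∀ i, none ∉ oddSet i := by decide
    exact this i
  · have : ∀ i, Odd (oddSet i).card := by decide
    rw [Set.ncard_coe_finset]
    exact this i
  · intro d hd
    refine hi d ?_
    have : edgeFun _ _ _ _ _ _ _ _ _ _ _ _ _ _ _ d = f d := (congrFun e d).symm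
    exact this.trans (decide_eq_true hd)

lemma petersen_port_fst_ne (k : Fin 3) : (petersen.port k).1 ≠ 3 := by
  intro h
  have h1 := petersen.opp_none k
  rw [h] at h1
  have : ∀ k : Fin 3, (petersen.opp (none, k)).1 ≠ some 3 := by decide +kernel
  exact this k (congrArg Prod.fst h1)

lemma exists_far (n : ℕ) : ∃ (V : Type) (_ : Finite V) (G : CubicDartGraph V),
    G.ThreeConnected ∧ G.EvenConnected ∧ G.Far (n + 1) ∧ Nonempty V := by
  induction n with
  | zero =>
    exact ⟨_, inferInstance, petersen, petersen_threeConnected, petersen_evenConnected,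
      petersen_oddFactor.far, inferInstance⟩
  | succ n ih =>
    obtain ⟨V, _, G, h1, h2, h3, _⟩ := ih
    exact ⟨V × Fin 9, inferInstance, G.inflate petersen, h1.inflate petersen_threeConnected,
      h2.inflate (by simp; decide) petersen_evenConnected,
      h3.inflate (Nat.succ_pos n) 3 petersen_port_fst_ne, inferInstance⟩

end CubicDartGraph

/-! ### Walks and components of multigraphs -/

namespace Graph

variable {α β γ δ : Type*} {G : Graph α β}

lemma IsWalk.right_mem {x y : α} {w : List (β × α)} (h : G.IsWalk x w y) : y ∈ G.vertexSet := by
  induction w generalizing x with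
  | nil => exact h.2 ▸ h.1
  | cons p w ih => exact ih h.2

lemma IsWalk.left_mem {x y : α} {w : List (β × α)} (h : G.IsWalk x w y) : x ∈ G.vertexSet := by
  cases w with
  | nil => exact h.1
  | cons p w => exact IsLink.left_mem h.1

lemma IsWalk.concat {x y z : α} {w : List (β × α)} {e : β} (h : G.IsWalk x w y)
    (he : G.IsLink e y z) : G.IsWalk x (w ++ [(e, z)]) z := by
  induction w generalizing x with
  | nil => exact ⟨h.2 ▸ he, he.right_mem, rfl⟩
  | cons p w ih => exact ⟨h.1, ih h.2⟩

lemma IsWalk.edge_mem {x y : α} {w : List (β × α)} (h : G.IsWalk x w y) {f : β}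
    (hf : f ∈ w.map Prod.fst) : f ∈ G.edgeSet := by
  induction w generalizing x with
  | nil => simp at hf
  | cons p w ih =>
    rcases List.mem_cons.1 hf with rfl | hf
    · exact IsLink.edge_mem h.1
    · exact ih h.2 hf

lemma IsWalk.mem_iff_mem {x y : α} {w : List (β × α)} (h : G.IsWalk x w y) {S : Set α}
    (hS : ∀ f ∈ w.map Prod.fst, ∀ a b, G.IsLink f a b → a ∈ S → b ∈ S) : x ∈ S ↔ y ∈ S := by
  induction w generalizing x with
  | nil => rw [h.2]
  | cons p w ih =>
    rw [← ih h.2 fun f hf => hS f (List.mem_cons_of_mem _ hf)]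
    exact ⟨hS _ List.mem_cons_self _ _ h.1, hS _ List.mem_cons_self _ _ (IsLink.symm h.1)⟩

/-- The trail uses `f` exactly once, and no other edge changes sides. -/
lemma IsWalk.mem_iff_notMem {x y : α} {w : List (β × α)} (h : G.IsWalk x w y) {S : Set α} {f : β}
    (hw : (w.map Prod.fst).Nodup) (hf : f ∈ w.map Prod.fst)
    (hfS : ∀ a b, G.IsLink f a b → (a ∈ S ↔ b ∉ S))
    (hS : ∀ g, g ≠ f → ∀ a b, G.IsLink g a b → a ∈ S → b ∈ S) : x ∈ S ↔ y ∉ S := by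
  induction w generalizing x with
  | nil => simp at hf
  | cons p w ih =>
    obtain ⟨hp, hw⟩ := List.nodup_cons.1 hw
    rcases List.mem_cons.1 hf with rfl | hf
    · rw [hfS _ _ h.1, h.2.mem_iff_mem fun g hg => hS g (by rintro rfl; exact hp hg)]
    · have hpf : p.1 ≠ f := by rintro rfl; exact hp hf
      rw [← ih h.2 hw hf]
      exact ⟨hS _ hpf _ _ h.1, hS _ hpf _ _ (IsLink.symm h.1)⟩

lemma IsWalk.exists_crossing {x y : α} {w : List (β × α)} (h : G.IsWalk x w y) {S : Set α}
    (hx : x ∈ S) (hy : y ∉ S) : ∃ f a b, G.IsLink f a b ∧ a ∈ S ∧ b ∉ S ∧ b ∈ w.map Prod.snd := by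
  induction w generalizing x with
  | nil => exact absurd (h.2 ▸ hx) hy
  | cons p w ih =>
    by_cases hp : p.2 ∈ S
    · obtain ⟨f, a, b, h1, h2, h3, h4⟩ := ih h.2 hp
      exact ⟨f, a, b, h1, h2, h3, List.mem_cons_of_mem _ h4⟩
    · exact ⟨p.1, x, p.2, h.1, hx, hp, List.mem_cons_self⟩

lemma IsWalk.le_add_length {x y : α} {w : List (β × α)} (h : G.IsWalk x w y) {g : α → ℕ}
    (hg : ∀ e a b, G.IsLink e a b → g a ≤ g b + 1) : g y ≤ g x + w.length := by
  induction w generalizing x with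
  | nil => rw [h.2]; simp
  | cons p w ih =>
    have h1 := hg _ _ _ (IsLink.symm h.1)
    have h2 := ih h.2
    simp only [List.length_cons]
    omega

lemma IsConnected.mem_of_closed (hG : G.IsConnected) {S : Set α}
    (hS : ∀ f a b, G.IsLink f a b → a ∈ S → b ∈ S) {x y : α} (hx : x ∈ G.vertexSet)
    (hy : y ∈ G.vertexSet) (hxS : x ∈ S) : y ∈ S := by
  obtain ⟨w, hw⟩ := hG.2 x hx y hy
  exact (hw.mem_iff_mem fun f _ => hS f).1 hxS

lemma isConnected_of_closed (hne : G.vertexSet.Nonempty)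
    (h : ∀ S : Set α, (∀ f a b, G.IsLink f a b → a ∈ S → b ∈ S) → ∀ x ∈ G.vertexSet,
      ∀ y ∈ G.vertexSet, x ∈ S → y ∈ S) : G.IsConnected :=
  ⟨hne, fun x hx y hy => h {z | ∃ w, G.IsWalk x w z}
    (fun _ _ _ he ⟨_, hw⟩ => ⟨_, hw.concat he⟩) x hx y hy ⟨[], hx, rfl⟩⟩

lemma IsConnected.isComponent_self (hG : G.IsConnected) : G.IsComponent G :=
  ⟨.mk' le_rfl fun _ _ he _ => he.edge_mem, hG⟩

/-- The connected component of a vertex. -/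
def componentOf (G : Graph α β) (x : α) : Graph α β := G.induce {y | ∃ w, G.IsWalk x w y}

lemma mem_componentOf_self {x : α} (hx : x ∈ G.vertexSet) : x ∈ (G.componentOf x).vertexSet :=
  ⟨[], hx, rfl⟩

lemma componentOf_isLink {x : α} {e : β} {a b : α} (h : G.IsLink e a b)
    (ha : a ∈ (G.componentOf x).vertexSet) : (G.componentOf x).IsLink e a b :=
  ⟨h, ha, ha.imp' _ fun _ hw => hw.concat h⟩

lemma componentOf_isComponent {x : α} (hx : x ∈ G.vertexSet) :
    (G.componentOf x).IsComponent G := by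
  refine ⟨.mk' (induce_le fun y ⟨w, hw⟩ => hw.right_mem) ?_, ?_⟩
  · rintro e a ⟨b, he⟩ ha
    exact (componentOf_isLink he ha).edge_mem
  · refine isConnected_of_closed ⟨x, mem_componentOf_self hx⟩ ?_
    intro S hS
    have key : ∀ y ∈ (G.componentOf x).vertexSet, x ∈ S ↔ y ∈ S := by
      rintro y ⟨w, hw⟩
      have := (hw.mem_iff_mem (S := {z | z ∈ (G.componentOf x).vertexSet ∧ (z ∈ S ↔ x ∈ S)}) ?_).1
        ⟨mem_componentOf_self hx, Iff.rfl⟩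
      · exact this.2.symm
      · rintro f - a b he ⟨ha, hxa⟩
        have hl := componentOf_isLink he ha
        exact ⟨hl.right_mem, ⟨fun hb => hxa.1 (hS _ _ _ hl.symm hb), fun h => hS _ _ _ hl (hxa.2 h)⟩⟩
    intro y hy z hz hyS
    exact (key z hz).1 ((key y hy).2 hyS)

/-- A closed set is a union of components, which are split off one at a time. -/
lemma even_ncard_of_closed (hfin : G.vertexSet.Finite)
    (hG : ∀ K : Graph α β, K.IsComponent G → Even K.vertexSet.ncard) (S : Set α)
    (hSG : S ⊆ G.vertexSet) (hS : ∀ f a b, G.IsLink f a b → a ∈ S → b ∈ S) : Even S.ncard := by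
  induction hn : S.ncard using Nat.strong_induction_on generalizing S with
  | _ n ih =>
    subst hn
    rcases S.eq_empty_or_nonempty with rfl | ⟨x, hx⟩
    · simp
    have hK := componentOf_isComponent (hSG hx)
    have hsub : (G.componentOf x).vertexSet ⊆ S := by
      rintro y ⟨w, hw⟩
      exact (hw.mem_iff_mem fun f _ => hS f).1 hx
    have hSfin := hfin.subset hSG
    have hadd := Set.ncard_sdiff_add_ncard_of_subset hsub hSfin
    have hpos : 0 < (G.componentOf x).vertexSet.ncard :=
      (Set.ncard_pos (hSfin.subset hsub)).2 ⟨x, mem_componentOf_self (hSG hx)⟩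
    rw [← hadd]
    refine (ih _ (by omega) (S \ (G.componentOf x).vertexSet) (Set.sdiff_subset.trans hSG) ?_
      rfl).add (hG _ hK)
    rintro f a b he ⟨ha, ha'⟩
    exact ⟨hS _ _ _ he ha, fun hb => ha' (componentOf_isLink he.symm hb).right_mem⟩

/-! ### Subdivisions -/

/-- Let `f` lie on the path of `e`. That path crosses the cut once, so its ends are separated; but
`A - e` is connected, and the paths of its edges avoid `f` and stay on one side. -/
lemma IsSubdivision.not_bridge {H : Graph γ δ} {A : Graph α β} (h : H.IsSubdivision A)
    (hA : A.IsTwoConnected) {f : δ} (hf : f ∈ H.edgeSet) {S : Set γ}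
    (hfS : ∀ a b, H.IsLink f a b → (a ∈ S ↔ b ∉ S))
    (hS : ∀ g, g ≠ f → ∀ a b, H.IsLink g a b → a ∈ S → b ∈ S) : False := by
  obtain ⟨φ, P, -, hP, hdisj, -, hE⟩ := h
  rw [hE] at hf
  obtain ⟨e, he, hfe⟩ := hf
  obtain ⟨-, ⟨x, y, hxy, hw⟩, hnodup, -⟩ := hP e he
  have h1 := hw.mem_iff_notMem hnodup hfe hfS hS
  have h2 := hA.2.2.2 e he
  have hcl : ∀ e' a b, (A.deleteEdges {e}).IsLink e' a b → φ a ∈ S → φ b ∈ S := by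
    intro e' a b hl ha
    rw [deleteEdges_isLink] at hl
    obtain ⟨hl, hne⟩ := hl
    have hd := (hdisj e he e' hl.edge_mem (Ne.symm hne)).1
    obtain ⟨-, ⟨x', y', hxy', hw'⟩, -⟩ := hP e' hl.edge_mem
    have h3 := hw'.mem_iff_mem (S := S) fun g hg => hS g (by rintro rfl; exact hd hfe hg)
    rcases hl.eq_and_eq_or_eq_and_eq hxy' with ⟨rfl, rfl⟩ | ⟨rfl, rfl⟩
    · exact h3.1 ha
    · exact h3.2 ha
  have hx : x ∈ (A.deleteEdges {e}).vertexSet := by simpa using hxy.left_mem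
  have hy : y ∈ (A.deleteEdges {e}).vertexSet := by simpa using hxy.right_mem
  have h3 := h2.mem_of_closed (S := φ ⁻¹' S) hcl hx hy
  have h4 := h2.mem_of_closed (S := φ ⁻¹' S) hcl hy hx
  simp only [Set.mem_preimage] at h3 h4
  tauto

lemma IsWalk.map_snd_eq {x y : α} {w : List (β × α)} (h : G.IsWalk x w y) (hw : w ≠ []) :
    w.map Prod.snd = innerVertices w ++ [y] := by
  induction w generalizing x with
  | nil => contradiction
  | cons p w ih =>
    cases w with
    | nil => simp [innerVertices, h.2.2]
    | cons q w =>
      have := ih h.2 (by simp)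
      rw [List.map_cons, this]
      rfl

lemma IsWalk.mem_of_inc {x y v : α} {w : List (β × α)} (h : G.IsWalk x w y) {f : β}
    (hf : f ∈ w.map Prod.fst) (hv : G.Inc f v) : v = x ∨ v ∈ w.map Prod.snd := by
  induction w generalizing x with
  | nil => simp at hf
  | cons p w ih =>
    rcases List.mem_cons.1 hf with rfl | hf
    · rcases hv.eq_or_eq_of_isLink h.1 with rfl | rfl
      · exact Or.inl rfl
      · exact Or.inr List.mem_cons_self
    · rcases ih h.2 hf with rfl | h
      · exact Or.inr List.mem_cons_self
      · exact Or.inr (List.mem_cons_of_mem _ h)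

lemma IsWalk.exists_inc_eq_left {x y : α} {w : List (β × α)} (h : G.IsWalk x w y) (hxy : x ≠ y)
    (hx : x ∉ w.map Prod.snd) : ∃ f, ∀ g ∈ w.map Prod.fst, G.Inc g x → g = f := by
  cases w with
  | nil => exact absurd h.2 hxy
  | cons p w =>
    refine ⟨p.1, fun g hg hgx => ?_⟩
    rcases List.mem_cons.1 hg with rfl | hg
    · rfl
    · simp only [List.map_cons, List.mem_cons, not_or] at hx
      rcases h.2.mem_of_inc hg hgx with h1 | h1
      · exact absurd h1 hx.1
      · exact absurd h1 hx.2

lemma IsWalk.exists_inc_eq {x y v : α} {w : List (β × α)} (h : G.IsWalk x w y) (hvx : v ≠ x)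
    (hvy : v ≠ y) (hv : v ∈ w.map Prod.snd) (hw : (w.map Prod.snd).Nodup) :
    ∃ f f', ∀ g ∈ w.map Prod.fst, G.Inc g v → g = f ∨ g = f' := by
  induction w generalizing x with
  | nil => simp at hv
  | cons p w ih =>
    obtain ⟨hp, hw⟩ := List.nodup_cons.1 hw
    by_cases hvp : v = p.2
    · subst hvp
      obtain ⟨f, hf⟩ := h.2.exists_inc_eq_left hvy hp
      refine ⟨p.1, f, fun g hg hgv => ?_⟩
      rcases List.mem_cons.1 hg with rfl | hg
      · exact Or.inl rfl
      · exact Or.inr (hf g hg hgv)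
    · obtain ⟨f, f', hf⟩ := ih h.2 hvp ((List.mem_cons.1 hv).resolve_left hvp) hw
      refine ⟨f, f', fun g hg hgv => ?_⟩
      rcases List.mem_cons.1 hg with rfl | hg
      · rcases hgv.eq_or_eq_of_isLink h.1 with h1 | h1 <;> contradiction
      · exact hf g hg hgv

/-- The data of a subdivision: the images `φ` of the vertices and the paths `P` that replace the
edges. -/
structure SubdivisionData (H : Graph γ δ) (A : Graph α β) (φ : α → γ)
    (P : β → List (δ × γ)) : Prop where
  path : ∀ e ∈ A.edgeSet, P e ≠ [] ∧ (∃ x y, A.IsLink e x y ∧ H.IsWalk (φ x) (P e) (φ y)) ∧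
      ((P e).map Prod.fst).Nodup ∧ (innerVertices (P e)).Nodup ∧
      ∀ v ∈ innerVertices (P e), v ∉ φ '' A.vertexSet
  disjoint : ∀ e ∈ A.edgeSet, ∀ e' ∈ A.edgeSet, e ≠ e' →
      List.Disjoint ((P e).map Prod.fst) ((P e').map Prod.fst) ∧
      List.Disjoint (innerVertices (P e)) (innerVertices (P e'))
  vertexSet_eq : H.vertexSet = φ '' A.vertexSet ∪ {v | ∃ e ∈ A.edgeSet, v ∈ innerVertices (P e)}
  edgeSet_eq : H.edgeSet = {f | ∃ e ∈ A.edgeSet, f ∈ (P e).map Prod.fst}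

lemma IsSubdivision.exists_data {H : Graph γ δ} {A : Graph α β} (h : H.IsSubdivision A) :
    ∃ φ P, SubdivisionData H A φ P := by
  obtain ⟨φ, P, -, h1, h2, h3, h4⟩ := h
  exact ⟨φ, P, h1, h2, h3, h4⟩

namespace SubdivisionData

variable {H : Graph γ δ} {A : Graph α β} {φ : α → γ} {P : β → List (δ × γ)}

lemma mem_path_of_inc (h : SubdivisionData H A φ P) {e : β} (he : e ∈ A.edgeSet) {v : γ}
    (hv : v ∈ innerVertices (P e)) {f : δ} (hf : H.Inc f v) : f ∈ (P e).map Prod.fst := by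
  obtain ⟨e', he', hfe⟩ : f ∈ {f | ∃ e ∈ A.edgeSet, f ∈ (P e).map Prod.fst} :=
    h.edgeSet_eq ▸ hf.edge_mem
  by_cases hee : e = e'
  · exact hee ▸ hfe
  obtain ⟨hne, ⟨x, y, hxy, hw⟩, -⟩ := h.path e' he'
  have hvφ := (h.path e he).2.2.2.2 v hv
  have := hw.mem_of_inc hfe hf
  rw [hw.map_snd_eq hne, List.mem_append, List.mem_singleton] at this
  rcases this with rfl | h1 | rfl
  · exact absurd ⟨x, hxy.left_mem, rfl⟩ hvφ
  · exact absurd h1 ((h.disjoint e he e' he' hee).2 hv)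
  · exact absurd ⟨y, hxy.right_mem, rfl⟩ hvφ

/-- Inner vertices of paths have degree at most two, so vertices of degree three are branch
vertices. -/
lemma exists_inc_eq (h : SubdivisionData H A φ P) {v : γ} (hv : v ∈ H.vertexSet)
    (hvφ : v ∉ φ '' A.vertexSet) : ∃ f f', ∀ g, H.Inc g v → g = f ∨ g = f' := by
  rw [h.vertexSet_eq] at hv
  obtain ⟨e, he, hve⟩ := hv.resolve_left hvφ
  obtain ⟨hne, ⟨x, y, hxy, hw⟩, -, hnodup, hφ⟩ := h.path e he
  have hsnd := hw.map_snd_eq hne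
  obtain ⟨f, f', hf⟩ := hw.exists_inc_eq (v := v)
    (fun hx => hvφ ⟨x, hxy.left_mem, hx.symm⟩) (fun hy => hvφ ⟨y, hxy.right_mem, hy.symm⟩)
    (by rw [hsnd]; simp [hve]) (by
      rw [hsnd, List.nodup_append]
      refine ⟨hnodup, by simp, fun a ha b hb hab => ?_⟩
      obtain rfl := List.mem_singleton.1 hb
      exact hφ a ha (hab ▸ ⟨y, hxy.right_mem, rfl⟩))
  exact ⟨f, f', fun g hg => hf g (h.mem_path_of_inc he hve hg) hg⟩

lemma mem_of_isLink (h : SubdivisionData H A φ P) {e : β} {x y : α} (he : A.IsLink e x y)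
    {v z : γ} (hv : v ∈ innerVertices (P e)) {f : δ} (hf : H.IsLink f v z) :
    z = φ x ∨ z = φ y ∨ z ∈ innerVertices (P e) := by
  obtain ⟨hne, ⟨x', y', hxy, hw⟩, -⟩ := h.path e he.edge_mem
  have := hw.mem_of_inc (h.mem_path_of_inc he.edge_mem hv hf.inc_left) hf.inc_right
  rw [hw.map_snd_eq hne, List.mem_append, List.mem_singleton] at this
  rcases he.eq_and_eq_or_eq_and_eq hxy with ⟨rfl, rfl⟩ | ⟨rfl, rfl⟩ <;> tauto

end SubdivisionData

end Graph

/-! ### From dart graphs to multigraphs -/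

namespace CubicDartGraph

variable {V : Type*} {G : CubicDartGraph V}

/-- The undirected edge of a dart. -/
def edge (G : CubicDartGraph V) (d : V × Fin 3) : Sym2 (V × Fin 3) := s(d, G.opp d)

lemma edge_eq_edge_iff {d d' : V × Fin 3} : G.edge d = G.edge d' ↔ d = d' ∨ d = G.opp d' := by
  rw [edge, edge, Sym2.eq_iff]
  constructor
  · rintro (⟨h, -⟩ | ⟨h, -⟩)
    · exact Or.inl h
    · exact Or.inr h
  · rintro (rfl | rfl)
    · exact Or.inl ⟨rfl, rfl⟩
    · exact Or.inr ⟨rfl, G.opp_opp _⟩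

lemma edge_opp (d : V × Fin 3) : G.edge (G.opp d) = G.edge d := edge_eq_edge_iff.2 (Or.inr rfl)

/-- The multigraph of a dart graph. -/
def toGraph (G : CubicDartGraph V) : Graph V (Sym2 (V × Fin 3)) where
  vertexSet := Set.univ
  IsLink e x y := ∃ d, e = G.edge d ∧ d.1 = x ∧ (G.opp d).1 = y
  isLink_symm e _ := ⟨by
    rintro x y ⟨d, rfl, rfl, rfl⟩
    exact ⟨G.opp d, (edge_opp d).symm, rfl, by rw [G.opp_opp]⟩⟩
  eq_or_eq_of_isLink_of_isLink := by
    rintro _ _ _ _ _ ⟨d, rfl, rfl, rfl⟩ ⟨d', h, rfl, rfl⟩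
    exact (edge_eq_edge_iff.1 h).imp (congrArg _) (congrArg _)
  left_mem_of_isLink _ _ _ _ := trivial

lemma toGraph_isLink_edge (d : V × Fin 3) : G.toGraph.IsLink (G.edge d) d.1 (G.opp d).1 :=
  ⟨d, rfl, rfl, rfl⟩

lemma edge_injective (v : V) : Function.Injective fun i => G.edge (v, i) := by
  intro i j h
  rcases edge_eq_edge_iff.1 h with h | h
  · exact congrArg Prod.snd h
  · exact absurd (congrArg Prod.fst h).symm (G.loopless (v, j))

lemma toGraph_isFinite [Finite V] : G.toGraph.IsFinite := ⟨Set.toFinite _, Set.toFinite _⟩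

lemma toGraph_isCubic : G.toGraph.IsCubic := by
  intro v _
  have h1 : G.toGraph.incidenceSet v = Set.range fun i => G.edge (v, i) := by
    ext e
    constructor
    · rintro ⟨y, ⟨x, i⟩, rfl, rfl, -⟩
      exact ⟨i, rfl⟩
    · rintro ⟨i, rfl⟩
      exact ⟨_, toGraph_isLink_edge (v, i)⟩
  have h2 : G.toGraph.loopSet v = ∅ := by
    rw [Set.eq_empty_iff_forall_notMem]
    rintro e ⟨d, -, h1, h2⟩
    exact G.loopless d (h2.trans h1.symm)
  rw [Graph.deg, h1, h2, ← Set.image_univ, (edge_injective v).encard_image]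
  simp

lemma three_lt_encard_univ [Nonempty V] (G : CubicDartGraph V) :
    3 < (Set.univ : Set V).encard := by
  obtain ⟨v⟩ := ‹Nonempty V›
  have hinj : Function.Injective fun x : Option (Fin 3) =>
      x.elim v fun i => (G.opp (v, i)).1 := by
    rintro (_ | i) (_ | j) h
    · rfl
    · exact absurd h.symm (G.loopless (v, j))
    · exact absurd h (G.loopless (v, i))
    · rw [G.simple v i j h]
  have h1 := hinj.encard_image Set.univ
  have h2 : (Set.univ : Set (Option (Fin 3))).encard = 4 := by
    rw [Set.encard_univ, ENat.card_eq_coe_fintype_card]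
    rfl
  rw [h2] at h1
  have h3 := Set.encard_le_encard (Set.subset_univ
    ((fun x : Option (Fin 3) => x.elim v fun i => (G.opp (v, i)).1) '' Set.univ))
  rw [h1] at h3
  exact lt_of_lt_of_le (by norm_num) h3

theorem ThreeConnected.toGraph [Nonempty V] (hG : G.ThreeConnected) :
    G.toGraph.IsThreeConnected := by
  refine ⟨G.three_lt_encard_univ, fun X _ hX => ?_⟩
  have ne_of : ∀ Y : Set V, Y.encard ≤ 3 → ∃ z, z ∉ Y := by
    intro Y hY
    rw [← Set.ne_univ_iff_exists_notMem]
    rintro rfl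
    exact absurd G.three_lt_encard_univ (not_lt.2 hY)
  obtain ⟨x₀, hx₀⟩ := ne_of X (hX.le)
  refine Graph.isConnected_of_closed ⟨x₀, trivial, hx₀⟩ ?_
  rintro S hS x ⟨-, hx⟩ y ⟨-, hy⟩ hxS
  have hS' : ∀ d : V × Fin 3, d.1 ∉ X → (G.opp d).1 ∉ X → d.1 ∈ S → (G.opp d).1 ∈ S := by
    intro d h1 h2
    refine hS (G.edge d) _ _ ?_
    rw [Graph.deleteVerts_isLink]
    exact ⟨toGraph_isLink_edge d, h1, h2⟩
  -- The dart version deletes a pair `a`, `b`, possibly equal. A smaller `X` is padded; if it is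
  -- empty, `a` is chosen outside `{x, y}`.
  obtain ⟨a, b, hXab, hxa, hxb, hya, hyb⟩ : ∃ a b, X ⊆ {a, b} ∧ x ≠ a ∧ x ≠ b ∧ y ≠ a ∧ y ≠ b := by
    have hX2 : X.encard ≤ 2 := by
      refine Order.le_of_lt_add_one ?_
      rwa [show (2 : ℕ∞) + 1 = 3 by norm_num]
    rcases X.eq_empty_or_nonempty with rfl | ⟨a, ha⟩
    · obtain ⟨a, ha⟩ := ne_of {x, y} ((Set.encard_insert_le _ _).trans (by simp; norm_num))
      simp only [Set.mem_insert_iff, Set.mem_singleton_iff, not_or] at ha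
      exact ⟨a, a, by simp, Ne.symm ha.1, Ne.symm ha.1, Ne.symm ha.2, Ne.symm ha.2⟩
    · have h1 : (X \ {a}).encard ≤ 1 := by
        have := Set.encard_sdiff_singleton_add_one ha
        rw [← this] at hX2
        have h3 : (X \ {a}).encard + 1 ≤ 1 + 1 := hX2.trans (by norm_num)
        exact (ENat.add_le_add_iff_right (by simp)).1 h3
      have hne : ∀ z ∈ X, x ≠ z ∧ y ≠ z := fun z hz =>
        ⟨by rintro rfl; exact hx hz, by rintro rfl; exact hy hz⟩
      rcases (X \ {a}).eq_empty_or_nonempty with h2 | ⟨b, hb⟩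
      · refine ⟨a, a, ?_, (hne a ha).1, (hne a ha).1, (hne a ha).2, (hne a ha).2⟩
        simpa [Set.sdiff_eq_empty] using h2
      · refine ⟨a, b, fun z hz => ?_, (hne a ha).1, (hne b hb.1).1, (hne a ha).2, (hne b hb.1).2⟩
        by_cases hza : z = a
        · exact Or.inl hza
        · exact Or.inr (Set.encard_le_one_iff.1 h1 z b ⟨hz, hza⟩ hb)
  refine hG a b S (fun d h1 h2 h3 h4 => hS' d ?_ ?_) x y hxa hxb hya hyb hxS
  · exact fun h => (hXab h).elim h1 h2
  · exact fun h => (hXab h).elim h3 h4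

open Finset

variable {H : Graph V (Sym2 (V × Fin 3))}

lemma isLink_of_edge_mem (hH : H ≤ G.toGraph) {d : V × Fin 3} (hd : G.edge d ∈ H.edgeSet) :
    H.IsLink (G.edge d) d.1 (G.opp d).1 :=
  (Graph.IsSubgraph.isLink_iff hH hd).2 (toGraph_isLink_edge d)

lemma exists_dart_of_isLink (hH : H ≤ G.toGraph) {e : Sym2 (V × Fin 3)} {x y : V}
    (h : H.IsLink e x y) : ∃ d, G.edge d ∈ H.edgeSet ∧ e = G.edge d ∧ d.1 = x ∧ (G.opp d).1 = y := by
  obtain ⟨d, rfl, h1, h2⟩ := hH.isLink_mono h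
  exact ⟨d, h.edge_mem, rfl, h1, h2⟩

theorem evenBridgeless_of_components [Finite V] (hH : H.IsSpanningSubgraph G.toGraph)
    {α β : Type*} (hK : ∀ K : Graph V (Sym2 (V × Fin 3)), K.IsComponent H →
      (∃ A : Graph α β, A.IsTwoConnected ∧ K.IsSubdivision A) ∧ Even K.vertexSet.ncard) :
    G.EvenBridgeless fun d => G.edge d ∈ H.edgeSet := by
  have hV : ∀ x, x ∈ H.vertexSet := fun x => hH.vertexSet_eq ▸ (trivial : x ∈ G.toGraph.vertexSet)
  refine ⟨fun d hd => by rwa [edge_opp], ?_, ?_⟩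
  · rintro S ⟨d, ⟨hd, h1, h2⟩, huniq⟩
    have hd' := isLink_of_edge_mem hH.le hd
    have hcomp := Graph.componentOf_isComponent (hV d.1)
    obtain ⟨⟨A, hA, hsub⟩, -⟩ := hK _ hcomp
    have hlink := Graph.componentOf_isLink hd' (Graph.mem_componentOf_self (hV d.1))
    refine hsub.not_bridge hA hlink.edge_mem (S := S) ?_ ?_
    · intro a b hab
      rcases hab.eq_and_eq_or_eq_and_eq hlink with ⟨rfl, rfl⟩ | ⟨rfl, rfl⟩ <;> tauto
    · intro g hg a b hab ha
      by_contra hb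
      obtain ⟨d', h3, rfl, rfl, rfl⟩ := exists_dart_of_isLink hH.le
        (hcomp.1.le.isLink_mono hab)
      exact hg (congrArg G.edge (huniq d' ⟨h3, ha, hb⟩))
  · intro S hS
    refine Graph.even_ncard_of_closed (Set.toFinite _) (fun K h => (hK K h).2) S
      (fun x _ => hV x) ?_
    intro f a b hab ha
    obtain ⟨d, h1, rfl, rfl, rfl⟩ := exists_dart_of_isLink hH.le hab
    exact hS d h1 ha

theorem EvenConnected.isConnected [Nonempty V] (hG : G.EvenConnected)
    (hH : H.IsSpanningSubgraph G.toGraph)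
    (hh : G.EvenBridgeless fun d => G.edge d ∈ H.edgeSet) : H.IsConnected := by
  refine Graph.isConnected_of_closed ?_ ?_
  · obtain ⟨x⟩ := ‹Nonempty V›
    exact ⟨x, hH.vertexSet_eq ▸ (trivial : x ∈ G.toGraph.vertexSet)⟩
  · intro S hS x _ y _ hx
    rcases hG _ hh S fun d hd h1 => hS _ _ _ (isLink_of_edge_mem hH.le hd) h1 with rfl | rfl
    · exact absurd hx (Set.notMem_empty x)
    · trivial

/-! ### The cycle modulo two of a closed trail -/

section Cycle

lemma sum_edge_eq [DecidableEq V] (d : V × Fin 3) (v : V) :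
    ∑ i, (if G.edge (v, i) = G.edge d then 1 else 0 : ZMod 2) =
      (if v = d.1 then 1 else 0) + if v = (G.opp d).1 then 1 else 0 := by
  have key : ∀ d : V × Fin 3, ∑ i, (if (v, i) = d then 1 else 0 : ZMod 2) =
      if v = d.1 then 1 else 0 := by
    rintro ⟨w, j⟩
    by_cases h : v = w <;> simp [h]
  rw [← key d, ← key (G.opp d), ← Finset.sum_add_distrib]
  refine Finset.sum_congr rfl fun i _ => ?_
  have hne : d ≠ G.opp d := fun h => G.loopless d (congrArg Prod.fst h.symm)
  simp only [edge_eq_edge_iff]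
  by_cases h1 : (v, i) = d
  · simp [h1, hne]
  · simp [h1]

lemma sum_mem_walk_eq [DecidableEq V] (hH : H ≤ G.toGraph) {x y : V} {w : List (Sym2 (V × Fin 3) × V)}
    (hw : H.IsWalk x w y) (hnodup : (w.map Prod.fst).Nodup) (v : V) :
    ∑ i, (if G.edge (v, i) ∈ w.map Prod.fst then 1 else 0 : ZMod 2) =
      (if v = x then 1 else 0) + if v = y then 1 else 0 := by
  induction w generalizing x with
  | nil =>
    obtain ⟨-, rfl⟩ := hw
    simp [CharTwo.add_self_eq_zero]
  | cons p w ih =>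
    obtain ⟨hp, hnodup⟩ := List.nodup_cons.1 hnodup
    obtain ⟨d, -, h2, rfl, h4⟩ := exists_dart_of_isLink hH hw.1
    have split : ∀ e : Sym2 (V × Fin 3), (if e ∈ (p :: w).map Prod.fst then 1 else 0 : ZMod 2) =
        (if e = G.edge d then 1 else 0) + if e ∈ w.map Prod.fst then 1 else 0 := by
      intro e
      by_cases h : e = p.1
      · have h' : e ∉ w.map Prod.fst := h ▸ hp
        rw [if_pos (by rw [h]; exact List.mem_cons_self), if_pos (h.trans h2), if_neg h', add_zero]
      · rw [if_neg (show e ≠ G.edge d from fun h' => h (h'.trans h2.symm)), zero_add]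
        simp only [List.map_cons, List.mem_cons, h, false_or]
    simp only [split]
    rw [Finset.sum_add_distrib, sum_edge_eq, ih hw.2 hnodup, h4, add_assoc,
      ← add_assoc (if v = p.2 then 1 else 0 : ZMod 2), CharTwo.add_self_eq_zero, zero_add]

variable {α β : Type*} {A : Graph α β} {φ : α → V} {P : β → List (Sym2 (V × Fin 3) × V)}

/-- The edges of the subdivision that subdivide the edges of the walk `w`. -/
def walkEdges (P : β → List (Sym2 (V × Fin 3) × V)) (w : List (β × α)) :
    List (Sym2 (V × Fin 3)) := w.flatMap fun p => (P p.1).map Prod.fst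

lemma mem_walkEdges {w : List (β × α)} {f : Sym2 (V × Fin 3)} :
    f ∈ walkEdges P w ↔ ∃ e ∈ w.map Prod.fst, f ∈ (P e).map Prod.fst := by
  simp only [walkEdges, List.mem_flatMap, List.mem_map]
  constructor
  · rintro ⟨p, h1, h2⟩
    exact ⟨p.1, ⟨p, h1, rfl⟩, h2⟩
  · rintro ⟨_, ⟨p, h1, rfl⟩, h2⟩
    exact ⟨p, h1, h2⟩

lemma sum_mem_walkEdges_eq [DecidableEq V] (hH : H ≤ G.toGraph) (hd : Graph.SubdivisionData H A φ P) {x y : α}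
    {w : List (β × α)} (hw : A.IsWalk x w y) (hnodup : (w.map Prod.fst).Nodup) (v : V) :
    ∑ i, (if G.edge (v, i) ∈ walkEdges P w then 1 else 0 : ZMod 2) =
      (if v = φ x then 1 else 0) + if v = φ y then 1 else 0 := by
  induction w generalizing x with
  | nil =>
    obtain ⟨-, rfl⟩ := hw
    simp [walkEdges, CharTwo.add_self_eq_zero]
  | cons p w ih =>
    obtain ⟨hp, hnodup⟩ := List.nodup_cons.1 hnodup
    have hpA : p.1 ∈ A.edgeSet := Graph.IsLink.edge_mem hw.1
    obtain ⟨-, ⟨x', y', hxy, hpw⟩, hpn, -⟩ := hd.path p.1 hpA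
    have hsum := sum_mem_walk_eq hH hpw hpn v
    have hsum' : ∑ i, (if G.edge (v, i) ∈ (P p.1).map Prod.fst then 1 else 0 : ZMod 2) =
      (if v = φ x then 1 else 0) + if v = φ p.2 then 1 else 0 := by
      rcases hxy.eq_and_eq_or_eq_and_eq hw.1 with ⟨rfl, rfl⟩ | ⟨rfl, rfl⟩
      · exact hsum
      · rw [hsum, add_comm]
    have split : ∀ e : Sym2 (V × Fin 3), (if e ∈ walkEdges P (p :: w) then 1 else 0 : ZMod 2) =
        (if e ∈ (P p.1).map Prod.fst then 1 else 0) + if e ∈ walkEdges P w then 1 else 0 := by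
      intro e
      have h0 : e ∈ walkEdges P (p :: w) ↔ e ∈ (P p.1).map Prod.fst ∨ e ∈ walkEdges P w := by
        rw [walkEdges, List.flatMap_cons, List.mem_append]
        rfl
      by_cases h : e ∈ (P p.1).map Prod.fst
      · have h' : e ∉ walkEdges P w := by
          intro h'
          obtain ⟨e', h1, h2⟩ := mem_walkEdges.1 h'
          exact (hd.disjoint p.1 hpA e' (hw.2.edge_mem h1) (by rintro rfl; exact hp h1)).1 h h2
        rw [if_pos (h0.2 (Or.inl h)), if_pos h, if_neg h', add_zero]
      · simp only [h0, h, false_or, if_false, zero_add]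
    simp only [split]
    rw [Finset.sum_add_distrib, hsum', ih hw.2 hnodup, add_assoc,
      ← add_assoc (if v = φ p.2 then 1 else 0 : ZMod 2), CharTwo.add_self_eq_zero, zero_add]

lemma mem_iff_of_mem_walk (hd : Graph.SubdivisionData H A φ P) {x y : α}
    {w : List (β × α)} (hw : A.IsWalk x w y) {S : Set V}
    (hS : ∀ f ∈ walkEdges P w, ∀ a b, H.IsLink f a b → a ∈ S → b ∈ S) {u : α}
    (hu : u = x ∨ u ∈ w.map Prod.snd) : φ x ∈ S ↔ φ u ∈ S := by
  rcases hu with rfl | hu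
  · rfl
  induction w generalizing x with
  | nil => simp at hu
  | cons p w ih =>
    have hpA : p.1 ∈ A.edgeSet := Graph.IsLink.edge_mem hw.1
    obtain ⟨-, ⟨x', y', hxy, hpw⟩, -⟩ := hd.path p.1 hpA
    have h1 := hpw.mem_iff_mem (S := S) fun f hf =>
      hS f (mem_walkEdges.2 ⟨p.1, List.mem_cons_self, hf⟩)
    have h2 : φ x ∈ S ↔ φ p.2 ∈ S := by
      rcases hxy.eq_and_eq_or_eq_and_eq hw.1 with ⟨rfl, rfl⟩ | ⟨rfl, rfl⟩
      · exact h1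
      · exact h1.symm
    rcases List.mem_cons.1 hu with rfl | hu
    · exact h2
    · refine h2.trans (ih hw.2 (fun f hf => hS f ?_) hu)
      obtain ⟨e, h3, h4⟩ := mem_walkEdges.1 hf
      exact mem_walkEdges.2 ⟨e, List.mem_cons_of_mem _ h3, h4⟩

end Cycle

/-! ### Subdivisions in inflated graphs -/

section Inflate

variable {Q : Type*} {N : CubicDartGraph (Option Q)}
  {H : Graph (V × Q) (Sym2 ((V × Q) × Fin 3))}
  {α β : Type*} {A : Graph α β} {φ : α → V × Q}
  {P : β → List (Sym2 ((V × Q) × Fin 3) × (V × Q))}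

lemma mem_image_of_branch {W : Type*} {G : CubicDartGraph W} {H : Graph W (Sym2 (W × Fin 3))}
    {φ : α → W} {P : β → List (Sym2 (W × Fin 3) × W)}
    (hH : H ≤ G.toGraph) (hd : Graph.SubdivisionData H A φ P) {v : W}
    (hv : ∀ i, G.edge (v, i) ∈ H.edgeSet) : v ∈ φ '' A.vertexSet := by
  by_contra hφ
  have hinc : ∀ i, H.Inc (G.edge (v, i)) v := fun i => (isLink_of_edge_mem hH (hv i)).inc_left
  obtain ⟨f, f', hf⟩ := hd.exists_inc_eq (hinc 0).vertex_mem hφ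
  have hinj := fun i j => @edge_injective W G v i j
  have h0 := hf _ (hinc 0)
  have h1 := hf _ (hinc 1)
  have h2 := hf _ (hinc 2)
  have h01 : G.edge (v, 0) ≠ G.edge (v, 1) := fun h => by simpa using hinj 0 1 h
  have h02 : G.edge (v, 0) ≠ G.edge (v, 2) := fun h => by simpa using hinj 0 2 h
  have h12 : G.edge (v, 1) ≠ G.edge (v, 2) := fun h => by simpa using hinj 1 2 h
  rcases h0 with h0 | h0 <;> rcases h1 with h1 | h1 <;> rcases h2 with h2 | h2
  all_goals first
    | exact h01 (h0.trans h1.symm)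
    | exact h02 (h0.trans h2.symm)
    | exact h12 (h1.trans h2.symm)

/-- A path that replaces an edge meets only the copies of `N - none` that contain its ends. -/
lemma fst_of_mem_innerVertices [Finite Q] (hQ : Odd (Nat.card Q)) (hN : N.EvenConnected)
    (hN' : N.OddFactor) (hH : H ≤ (G.inflate N).toGraph)
    (hh : (G.inflate N).EvenBridgeless fun d => (G.inflate N).edge d ∈ H.edgeSet)
    (hd : Graph.SubdivisionData H A φ P) {e : β} {x y : α} (he : A.IsLink e x y) {z : V × Q}
    (hz : z ∈ Graph.innerVertices (P e)) : z.1 = (φ x).1 ∨ z.1 = (φ y).1 := by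
  -- The part of the path in a copy without its ends is closed under `H` inside that copy. Since `H`
  -- is connected there, the path would fill the copy, including a branch vertex.
  by_contra! hc
  obtain ⟨v, q₀⟩ := z
  rcases hh.piece_connected hQ hN v {q | (v, q) ∈ Graph.innerVertices (P e)} (by
    intro q i q' i' ho hl hq
    have hlink := isLink_of_edge_mem hH hl
    rw [ho] at hlink
    rcases hd.mem_of_isLink he hq hlink with h | h | h
    · exact absurd (congrArg Prod.fst h) hc.1
    · exact absurd (congrArg Prod.fst h) hc.2
    · exact h) with h | h
  · exact (h ▸ hz : q₀ ∈ (∅ : Set Q))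
  · obtain ⟨q, hq⟩ := hh.exists_branch hQ hN' v
    exact (hd.path e he.edge_mem).2.2.2.2 (v, q) (h ▸ Set.mem_univ q :
      q ∈ {q | (v, q) ∈ Graph.innerVertices (P e)}) (mem_image_of_branch hH hd hq)

lemma le_add_one_of_isLink [Finite Q] (hQ : Odd (Nat.card Q)) (hN : N.EvenConnected)
    (hN' : N.OddFactor) (hH : H ≤ (G.inflate N).toGraph)
    (hh : (G.inflate N).EvenBridgeless fun d => (G.inflate N).edge d ∈ H.edgeSet)
    (hd : Graph.SubdivisionData H A φ P) {f : V → ℕ} (hf : ∀ d, f d.1 ≤ f (G.opp d).1 + 1)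
    {e : β} {x y : α} (he : A.IsLink e x y) : f (φ x).1 ≤ f (φ y).1 + 1 := by
  have hf' : ∀ d, f (G.opp d).1 ≤ f d.1 + 1 := fun d => by simpa [G.opp_opp] using hf (G.opp d)
  obtain ⟨hne, ⟨x', y', hxy, hw⟩, -⟩ := hd.path e he.edge_mem
  have key : f (φ x').1 ≤ f (φ y').1 + 1 ∧ f (φ y').1 ≤ f (φ x').1 + 1 := by
    by_cases hp : (φ y').1 = (φ x').1
    · rw [hp]
      exact ⟨Nat.le_succ _, Nat.le_succ _⟩
    -- The edge on which the path leaves the copy of one end must enter the copy of the other, so it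
    -- stems from an edge of `G`.
    · obtain ⟨g, a, b, hg, ha, hb, hbw⟩ :=
        hw.exists_crossing (S := {z | z.1 = (φ x').1}) rfl hp
      have hb' : b.1 = (φ y').1 := by
        rw [hw.map_snd_eq hne, List.mem_append, List.mem_singleton] at hbw
        rcases hbw with h | rfl
        · exact (fst_of_mem_innerVertices hQ hN hN' hH hh hd hxy h).resolve_left hb
        · rfl
      obtain ⟨d, -, rfl, h1, h2⟩ := exists_dart_of_isLink hH hg
      revert h1 h2
      refine inflate_cases (motive := fun d => d.1 = a → ((G.inflate N).opp d).1 = b → _) N ?_ ?_ d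
      · intro v q i q' i' ho h1 h2
        rw [inflate_opp_internal ho] at h2
        subst h1 h2
        exact absurd ha hb
      · intro d h1 h2
        rw [inflate_opp_lift] at h2
        have e1 : d.1 = (φ x').1 := (congrArg Prod.fst h1).trans ha
        have e2 : (G.opp d).1 = (φ y').1 := (congrArg Prod.fst h2).trans hb'
        rw [← e1, ← e2]
        exact ⟨hf d, hf' d⟩
  rcases he.eq_and_eq_or_eq_and_eq hxy with ⟨rfl, rfl⟩ | ⟨rfl, rfl⟩
  · exact key.1
  · exact key.2

/-- The edges subdividing the trail form a cycle modulo two of the inflated graph, which contracts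
to `G`; the function obtained there is pulled back along `fun a => (φ a).1`. The far vertex of `G`
is attained because its copy contains a branch vertex. -/
theorem Far.exists_lipschitz [Fintype Q] {n : ℕ} (hG : G.Far n) (hQ : Odd (Nat.card Q))
    (hN : N.EvenConnected) (hN' : N.OddFactor) (hH : H ≤ (G.inflate N).toGraph)
    (hh : (G.inflate N).EvenBridgeless fun d => (G.inflate N).edge d ∈ H.edgeSet)
    (hd : Graph.SubdivisionData H A φ P) {x : α} {w : List (β × α)} (hw : A.IsWalk x w x)
    (hnodup : (w.map Prod.fst).Nodup) :
    ∃ g : α → ℕ, (∀ e a b, A.IsLink e a b → g a ≤ g b + 1) ∧ g x = 0 ∧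
      (∀ u ∈ w.map Prod.snd, g u = 0) ∧ ∃ v ∈ A.vertexSet, n ≤ g v := by
  classical
  let D : (V × Q) × Fin 3 → ZMod 2 := fun d =>
    if (G.inflate N).edge d ∈ walkEdges P w then 1 else 0
  have hD : ∀ d, D ((G.inflate N).opp d) = D d := fun d => by simp only [D, edge_opp]
  have hdeg : ∀ v, ∑ i, D (v, i) = 0 := fun v =>
    (sum_mem_walkEdges_eq hH hd hw hnodup v).trans (CharTwo.add_self_eq_zero _)
  obtain ⟨f, h1, h2, v, h3⟩ := hG (fun d => D (N.lift d))
    {z | ∃ u, (u = x ∨ u ∈ w.map Prod.snd) ∧ z = (φ u).1}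
    (fun d => by rw [← inflate_opp_lift (G := G), hD]) (sum_lift_eq_zero hD hdeg) (by
      rintro S hS _ ⟨u, hu, rfl⟩ _ ⟨u', hu', rfl⟩ huS
      have hcl : ∀ f ∈ walkEdges P w, ∀ a b, H.IsLink f a b → a ∈ Prod.fst ⁻¹' S →
          b ∈ Prod.fst ⁻¹' S := by
        intro f hf a b hab ha
        obtain ⟨d, -, rfl, rfl, rfl⟩ := exists_dart_of_isLink hH hab
        revert hf ha
        clear hab
        revert d
        refine inflate_cases N ?_ ?_
        · intro v q i q' i' ho _ ha
          rw [inflate_opp_internal ho]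
          exact ha
        · intro d hf ha
          rw [inflate_opp_lift]
          exact hS d (by simp only [D, if_pos hf]; exact one_ne_zero) ha
      exact (mem_iff_of_mem_walk hd hw hcl hu').1 ((mem_iff_of_mem_walk hd hw hcl hu).2 huS))
  obtain ⟨q, hq⟩ := hh.exists_branch hQ hN' v
  obtain ⟨a, ha, hav⟩ := mem_image_of_branch hH hd hq
  refine ⟨fun a => f (φ a).1, fun e a b => le_add_one_of_isLink hQ hN hN' hH hh hd h1,
    h2 _ ⟨x, Or.inl rfl, rfl⟩, fun u hu => h2 _ ⟨u, Or.inr hu, rfl⟩, a, ha, ?_⟩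
  simpa only [hav] using h3

end Inflate

end CubicDartGraph

/-! ### Conclusion for factors of all 3-connected cubic graphs -/

namespace Graph

variable {α β : Type*}

/-- For every `n`, some element of an even subdivision-factor of all `3`-connected cubic graphs
has, for each of its closed trails, a vertex at distance at least `n`. -/
theorem IsEvenSubdivisionFactorOfAll.exists_lipschitz {S : Set (Graph α β)}
    (hS : ∀ A ∈ S, A.IsFinite ∧ A.IsTwoConnected) (hall : IsEvenSubdivisionFactorOfAll S) (n : ℕ) :
    ∃ A ∈ S, ∀ x w, A.IsWalk x w x → (w.map Prod.fst).Nodup →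
      ∃ g : α → ℕ, (∀ e a b, A.IsLink e a b → g a ≤ g b + 1) ∧ g x = 0 ∧
        (∀ u ∈ w.map Prod.snd, g u = 0) ∧ ∃ v ∈ A.vertexSet, n < g v := by
  open CubicDartGraph in
  obtain ⟨V, _, G, h3, heven, hfar, _⟩ := CubicDartGraph.exists_far n
  have hQ : Odd (Nat.card (Fin 9)) := by simp; decide
  obtain ⟨H, hH, hK⟩ := hall _ _ (G.inflate petersen).toGraph toGraph_isFinite
    (h3.inflate petersen_threeConnected).toGraph toGraph_isCubic
  have hh := evenBridgeless_of_components hH fun K hKH =>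
    ⟨(hK K hKH).1.imp fun A hA => ⟨(hS A hA.1).2, hA.2⟩, (hK K hKH).2⟩
  have hconn := (heven.inflate hQ petersen_evenConnected).isConnected hH hh
  obtain ⟨⟨A, hA, hsub⟩, -⟩ := hK H hconn.isComponent_self
  obtain ⟨φ, P, hd⟩ := hsub.exists_data
  exact ⟨A, hA, fun x w hw hnodup =>
    hfar.exists_lipschitz hQ petersen_evenConnected petersen_oddFactor hH.le hh hd hw hnodup⟩

lemma lt_nonHam {A : Graph α β} {n : ℕ} (h : ∀ x w, A.IsWalk x w x → (w.map Prod.fst).Nodup →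
      ∃ g : α → ℕ, (∀ e a b, A.IsLink e a b → g a ≤ g b + 1) ∧ g x = 0 ∧
        (∀ u ∈ w.map Prod.snd, g u = 0) ∧ ∃ v ∈ A.vertexSet, n < g v) : (n : ℕ∞) < A.nonHam := by
  refine (ENat.natCast_lt_natCast.2 (Nat.lt_succ_self n)).trans_le ?_
  refine le_iInf fun x => le_iInf fun w => le_iInf fun hw => ?_
  obtain ⟨g, h1, -, h2, v, hv, h3⟩ := h x w hw.1 hw.2.2.2
  refine le_iSup₂_of_le v hv ?_
  refine le_iInf fun u => le_iInf fun hu => le_iInf fun y => le_iInf fun hy => le_iInf fun w' =>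
    le_iInf fun hw' => ?_
  obtain rfl : y = v := hy
  have h4 := hw'.1.le_add_length h1
  rw [h2 u hu] at h4
  exact ENat.natCast_le_natCast.2 (by omega)

/-- A discrete intermediate value argument: `g` rises by at most one along an edge, so it takes all
values from `0` to `g v`. -/
lemma lt_ncard_vertexSet {A : Graph α β} (hfin : A.vertexSet.Finite) (hA : A.IsConnected)
    {g : α → ℕ} (hg : ∀ e a b, A.IsLink e a b → g a ≤ g b + 1) {x v : α} (hx : x ∈ A.vertexSet)
    (hv : v ∈ A.vertexSet) (hgx : g x = 0) : g v < A.vertexSet.ncard := by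
  have hsub : Set.Iic (g v) ⊆ g '' A.vertexSet := by
    intro k hk
    by_contra hne
    have hcl : ∀ f a b, A.IsLink f a b → a ∈ {z | g z < k} → b ∈ {z | g z < k} := by
      intro f a b hab ha
      have h1 := hg _ _ _ hab.symm
      have h2 : g b ≠ k := fun h => hne ⟨b, hab.right_mem, h⟩
      simp only [Set.mem_ofPred_eq] at ha ⊢
      omega
    have h3 : g x ≠ k := fun h => hne ⟨x, hx, h⟩
    have h4 : g v < k := hA.mem_of_closed hcl hx hv (show g x < k by omega)
    exact absurd hk (not_le.2 h4)
  have h1 := (Set.ncard_le_ncard hsub (hfin.image g)).trans (Set.ncard_image_le hfin)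
  rw [← Finset.coe_Iic, Set.ncard_coe_finset, Nat.card_Iic] at h1
  omega

end Graph

theorem theorem1 {α β : Type*} :
    (∀ S : Set (Graph α β),
      (∀ A ∈ S, A.IsFinite ∧ A.IsTwoConnected) →
      Graph.IsEvenSubdivisionFactorOfAll S →
      Graph.nonHamMax S = ⊤ ∧ ∀ n : ℕ, ∃ A ∈ S, (n : ℕ∞) < A.nonHam) ∧
    (∀ S : Set (Graph α β),
      S.Finite →
      (∀ A ∈ S, A.IsFinite ∧ A.IsTwoConnected) →
      ¬ Graph.IsEvenSubdivisionFactorOfAll S) := by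
  constructor
  · intro S hS hall
    have key : ∀ n : ℕ, ∃ A ∈ S, (n : ℕ∞) < A.nonHam := fun n =>
      (hall.exists_lipschitz hS n).imp fun A hA => ⟨hA.1, Graph.lt_nonHam hA.2⟩
    refine ⟨?_, key⟩
    rw [Graph.nonHamMax]
    split_ifs
    -- Even where a greatest value exists in `ℕ∞`, it exceeds every natural number.
    · refine ENat.eq_top_iff_forall_gt.2 fun n => ?_
      obtain ⟨A, hA, hn⟩ := key n
      exact hn.trans_le (le_sSup ⟨A, hA, rfl⟩)
    · rfl
  · intro S hfin hS hall
    obtain ⟨N, hN⟩ := (hfin.image fun A => A.vertexSet.ncard).bddAbove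
    obtain ⟨A, hA, hg⟩ := hall.exists_lipschitz hS N
    obtain ⟨hAfin, hA2⟩ := hS A hA
    obtain ⟨x, hx⟩ := hA2.2.1.1
    -- The trivial closed trail suffices: a vertex at distance more than `N` from `x` contradicts
    -- the bound `N` on the number of vertices, with no circuit needed.
    obtain ⟨g, h1, h2, -, v, hv, h3⟩ := hg x [] ⟨hx, rfl⟩ List.nodup_nil
    have h4 := Graph.lt_ncard_vertexSet hAfin.1 hA2.2.1 h1 hx hv h2
    have h5 := hN ⟨A, hA, rfl⟩
    simp only at h5
    omega
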